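/- Let $k$ be a field, let $n\ge 1$ be an integer, and let $R=k\langle x_0,\dots,x_n\rangle$ be the free algebra, $\mathbb{Z}$-graded by $\deg x_i=1$. Let $\mathsf{gr}\,R$ be the abelian category of finitely presented $\mathbb{Z}$-graded left $R$-modules with degree-preserving homomorphisms, let $\mathsf{fdim}\,R$ be its Serre subcategory of finite-dimensional modules, and let $\mathsf{coh}\,\mathbb{X}^n=\mathsf{qgr}\,R:=\mathsf{gr}\,R/\mathsf{fdim}\,R$ be the quotient category, with quotient functor $\pi^*:\mathsf{gr}\,R\to\mathsf{qgr}\,R$. For $i\in\mathbb{Z}$ let $R(i)$ be the graded module with $R(i)_j=R_{i+j}$, and put $\mathcal{O}(i)=\pi^*(R(i))$. Then: 1. $\mathsf{coh}\,\mathbb{X}^n$ has no indecomposable objects, no simple objects, and no noetherian objects other than $0$. 2. Every short exact sequence in $\mathsf{coh}\,\mathbb{X}^n$ splits. 3. Every object of $\mathsf{coh}\,\mathbb{X}^n$ is isomorphic to a finite direct sum of objects $\mathcal{O}(i)$, $i\in\mathbb{Z}$. More precisely, for every object $\mathcal{F}$ there is an integer $i_0$ such that for every $i\ge i_0$ there is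 an integer $r\ge 0$ (depending on $i$) with $\mathcal{F}\cong\mathcal{O}(-i)^{\oplus r}$. 4. If $\mathcal{F}$ and $\mathcal{G}$ are nonzero objects of $\mathsf{coh}\,\mathbb{X}^n$, then $\dim_k\operatorname{Hom}(\mathcal{F},\mathcal{G})=\infty$. 5. There is an isomorphism of additive groups from the Grothendieck group $K_0(\mathsf{coh}\,\mathbb{X}^n)$ to $\mathbb{Z}\big[\tfrac{1}{n+1}\big]$ that sends $[\mathcal{O}(i)]$ to $(n+1)^i$ for every $i\in\mathbb{Z}$. -/

import Mathlib

open CategoryTheory CategoryTheory.Limits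

noncomputable section

universe u

namespace FreeProj

/-! ### The free algebra and its grading -/

section Ring

variable (k : Type u) [Field k] (n : ℕ)

/-- The free algebra `R = k⟨x₀, …, xₙ⟩`. -/
abbrev FreeAlg : Type u := FreeAlgebra k (Fin (n + 1))

variable {n} in
/-- The monomial `x_{w₁} x_{w₂} ⋯` attached to a word `w` in the letters `0, …, n`. -/
def monom (w : List (Fin (n + 1))) : FreeAlg k n := (w.map (FreeAlgebra.ι k)).prod

/-- The degree `j` component of `R`, where every `xᵢ` has degree `1`: the `k`-span of the monomials
of length `j` (it is zero when `j < 0`). -/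
def homog (j : ℤ) : Submodule k (FreeAlg k n) :=
  Submodule.span k {a | ∃ w : List (Fin (n + 1)), (w.length : ℤ) = j ∧ monom k w = a}

/-- The monomials form a `k`-basis of `R`. -/
def monomBasis : Module.Basis (FreeMonoid (Fin (n + 1))) k (FreeAlg k n) :=
  FreeAlgebra.basisFreeMonoid k (Fin (n + 1))

lemma monomBasis_apply (w : List (Fin (n + 1))) :
    monomBasis k n (FreeMonoid.ofList w) = monom k w := by
  simp [monomBasis, FreeAlgebra.basisFreeMonoid, monom, FreeAlgebra.equivMonoidAlgebraFreeMonoid,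
    FreeMonoid.lift_apply]

variable {k n}

lemma monom_nil : monom k ([] : List (Fin (n + 1))) = 1 := rfl

lemma monom_cons (a : Fin (n + 1)) (w : List (Fin (n + 1))) :
    monom k (a :: w) = FreeAlgebra.ι k a * monom k w := by simp [monom]

lemma monom_append (v w : List (Fin (n + 1))) :
    monom k (v ++ w) = monom k v * monom k w := by simp [monom]

lemma monom_mem (w : List (Fin (n + 1))) : monom k w ∈ homog k n w.length :=
  Submodule.subset_span ⟨w, rfl, rfl⟩

lemma ι_mem (a : Fin (n + 1)) : FreeAlgebra.ι k a ∈ homog k n 1 := by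
  have := monom_mem (k := k) [a]
  simpa [monom] using this

lemma mul_mem_homog {i j : ℤ} {a b : FreeAlg k n} (ha : a ∈ homog k n i) (hb : b ∈ homog k n j) :
    a * b ∈ homog k n (i + j) := by
  have h : homog k n i * homog k n j ≤ homog k n (i + j) := by
    rw [homog, homog, Submodule.span_mul_span]
    refine Submodule.span_le.2 ?_
    rintro _ ⟨_, ⟨v, hv, rfl⟩, _, ⟨w, hw, rfl⟩, rfl⟩
    refine Submodule.subset_span ⟨v ++ w, by simp [← hv, ← hw], monom_append v w⟩
  exact h (Submodule.mul_mem_mul ha hb)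

lemma monom_ext {M : Type*} [AddCommGroup M] [Module k M] {f g : FreeAlg k n →ₗ[k] M}
    (h : ∀ w, f (monom k w) = g (monom k w)) : f = g :=
  (monomBasis k n).ext fun w => by
    have := h w.toList
    rwa [← monomBasis_apply] at this

lemma span_monom : Submodule.span k (Set.range (monom k (n := n))) = ⊤ := by
  rw [← (monomBasis k n).span_eq]
  congr 1
  ext x
  constructor
  · rintro ⟨w, rfl⟩; exact ⟨FreeMonoid.ofList w, monomBasis_apply k n w⟩
  · rintro ⟨w, rfl⟩; exact ⟨w.toList, (monomBasis_apply k n _).symm⟩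

/-- The linear map `R → R` with prescribed values on monomials. -/
def monomLift (φ : List (Fin (n + 1)) → FreeAlg k n) : FreeAlg k n →ₗ[k] FreeAlg k n :=
  (monomBasis k n).constr k fun w => φ w.toList

lemma monomLift_monom (φ : List (Fin (n + 1)) → FreeAlg k n) (w : List (Fin (n + 1))) :
    monomLift φ (monom k w) = φ w := by
  rw [← monomBasis_apply, monomLift, Module.Basis.constr_basis]; rfl

/-- A family of linear projections with the expected properties exhibits a grading. -/
lemma isInternal_of_proj {M : Type*} [AddCommGroup M] [Module k M] (deg : ℤ → Submodule k M)
    (p : ℤ → M →ₗ[k] M) (h₁ : ∀ j, ∀ m ∈ deg j, p j m = m)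
    (h₂ : ∀ i j, i ≠ j → ∀ m ∈ deg i, p j m = 0)
    (h₃ : ∀ m j, p j m ∈ deg j) (h₄ : ∀ m, ∃ s : Finset ℤ, ∑ j ∈ s, p j m = m) :
    DirectSum.IsInternal deg := by
  refine DirectSum.isInternal_submodule_of_iSupIndep_of_iSup_eq_top ?_ ?_
  · intro j
    rw [Submodule.disjoint_def]
    intro m hm hm'
    have hle : (⨆ i, ⨆ (_ : i ≠ j), deg i) ≤ LinearMap.ker (p j) :=
      iSup₂_le fun i hij x hx => h₂ i j hij x hx
    rw [← h₁ j m hm]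
    exact hle hm'
  · refine eq_top_iff.2 fun m _ => ?_
    obtain ⟨s, hs⟩ := h₄ m
    rw [← hs]
    exact Submodule.sum_mem _ fun j _ => Submodule.mem_iSup_of_mem j (h₃ m j)

lemma homog_isInternal : DirectSum.IsInternal (homog k n) := by
  classical
  let p : ℤ → FreeAlg k n →ₗ[k] FreeAlg k n := fun j =>
    monomLift fun w => if (w.length : ℤ) = j then monom k w else 0
  have hp : ∀ j w, p j (monom k w) = if (w.length : ℤ) = j then monom k w else 0 :=
    fun j w => monomLift_monom _ w
  have hind : ∀ (S : Submodule k (FreeAlg k n)), (∀ w, monom k w ∈ S) → ∀ m, m ∈ S := by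
    intro S hS m
    have : (⊤ : Submodule k (FreeAlg k n)) ≤ S := by
      rw [← span_monom]
      exact Submodule.span_le.2 (by rintro _ ⟨w, rfl⟩; exact hS w)
    exact this trivial
  refine DirectSum.isInternal_submodule_of_iSupIndep_of_iSup_eq_top ?_ ?_
  · intro j
    rw [Submodule.disjoint_def]
    intro m hm hm'
    have h1 : homog k n j ≤ LinearMap.eqLocus (p j) LinearMap.id := by
      refine Submodule.span_le.2 ?_
      rintro _ ⟨w, hw, rfl⟩
      simp [hp, hw]
    have h2 : (⨆ i, ⨆ (_ : i ≠ j), homog k n i) ≤ LinearMap.ker (p j) := by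
      refine iSup₂_le fun i hij => Submodule.span_le.2 ?_
      rintro _ ⟨w, hw, rfl⟩
      simp [hp, hw, hij]
    have h1' : p j m = m := h1 hm
    rw [← h1']
    exact h2 hm'
  · exact eq_top_iff.2 fun m _ => hind _ (fun w => Submodule.mem_iSup_of_mem _ (monom_mem w)) m

end Ring

/-! ### Graded modules -/

section GrMod

variable (k : Type u) [Field k] (n : ℕ)

/-- A `ℤ`-graded left module `M = ⨁ⱼ Mⱼ` over `R = k⟨x₀, …, xₙ⟩`. -/
structure GrMod where
  /-- The underlying set of the module. -/
  carrier : Type u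
  [addCommGroup : AddCommGroup carrier]
  [modk : Module k carrier]
  [modR : Module (FreeAlg k n) carrier]
  [tower : IsScalarTower k (FreeAlg k n) carrier]
  /-- The homogeneous components. -/
  deg : ℤ → Submodule k carrier
  isInternal : DirectSum.IsInternal deg
  smul_mem : ∀ {i j : ℤ} {a : FreeAlg k n} {m : carrier},
    a ∈ homog k n i → m ∈ deg j → a • m ∈ deg (i + j)

attribute [instance] GrMod.addCommGroup GrMod.modk GrMod.modR GrMod.tower

variable {k n}

namespace GrMod

/-- Morphisms of graded modules: `R`-linear maps that preserve degrees. -/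
@[ext]
structure Hom (M N : GrMod k n) where
  /-- The underlying linear map. -/
  lin : M.carrier →ₗ[FreeAlg k n] N.carrier
  map_deg : ∀ (j : ℤ) (m : M.carrier), m ∈ M.deg j → lin m ∈ N.deg j

instance : Category (GrMod k n) where
  Hom := Hom
  id M := ⟨LinearMap.id, fun _ _ h => h⟩
  comp f g := ⟨g.lin ∘ₗ f.lin, fun j m h => g.map_deg j _ (f.map_deg j m h)⟩

@[ext]
lemma hom_ext {M N : GrMod k n} {f g : M ⟶ N} (h : Hom.lin f = Hom.lin g) : f = g := Hom.ext h

lemma id_lin (M : GrMod k n) : Hom.lin (𝟙 M) = LinearMap.id := rfl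

lemma comp_lin {M N P : GrMod k n} (f : M ⟶ N) (g : N ⟶ P) :
    Hom.lin (f ≫ g) = Hom.lin g ∘ₗ Hom.lin f := rfl

/-- The `k`-subspace of degree-preserving maps among all `R`-linear maps. -/
def homSubmodule (M N : GrMod k n) : Submodule k (M.carrier →ₗ[FreeAlg k n] N.carrier) where
  carrier := {f | ∀ (j : ℤ) (m : M.carrier), m ∈ M.deg j → f m ∈ N.deg j}
  add_mem' hf hg j m h := add_mem (hf j m h) (hg j m h)
  zero_mem' _ _ _ := zero_mem _
  smul_mem' c _ hf j m h := Submodule.smul_mem _ c (hf j m h)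

/-- Morphisms are the elements of `homSubmodule`. -/
def homEquiv (M N : GrMod k n) : (M ⟶ N) ≃ homSubmodule M N where
  toFun f := ⟨Hom.lin f, Hom.map_deg f⟩
  invFun f := ⟨f.1, f.2⟩
  left_inv _ := rfl
  right_inv _ := rfl

instance (M N : GrMod k n) : AddCommGroup (M ⟶ N) := (homEquiv M N).addCommGroup

instance (M N : GrMod k n) : Module k (M ⟶ N) := (homEquiv M N).module k

lemma add_lin {M N : GrMod k n} (f g : M ⟶ N) : Hom.lin (f + g) = Hom.lin f + Hom.lin g := rfl

lemma zero_lin {M N : GrMod k n} : Hom.lin (0 : M ⟶ N) = 0 := rfl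

lemma smul_lin {M N : GrMod k n} (c : k) (f : M ⟶ N) : Hom.lin (c • f) = c • Hom.lin f := rfl

instance : Preadditive (GrMod k n) where
  add_comp _ _ _ f f' g := by
    apply hom_ext; simp only [comp_lin, add_lin, LinearMap.comp_add]
  comp_add _ _ _ f g g' := by
    apply hom_ext; simp only [comp_lin, add_lin, LinearMap.add_comp]

instance : Linear k (GrMod k n) where
  smul_comp X Y Z r f g := by
    apply hom_ext
    ext x
    exact LinearMap.map_smul_of_tower (Hom.lin g) r (Hom.lin f x)
  comp_smul X Y Z f r g := by
    apply hom_ext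
    ext x
    rfl

/-- The identification of a graded module with the direct sum of its components. -/
def decomp (M : GrMod k n) : DirectSum ℤ (fun i => M.deg i) ≃ₗ[k] M.carrier :=
  LinearEquiv.ofBijective (DirectSum.coeLinearMap M.deg)
    (show Function.Bijective (DirectSum.coeLinearMap M.deg) from M.isInternal)

/-- The projection of a graded module to its component of degree `j`. -/
def proj (M : GrMod k n) (j : ℤ) : M.carrier →ₗ[k] M.carrier :=
  (M.deg j).subtype ∘ₗ DirectSum.component k ℤ (fun i => M.deg i) j ∘ₗ
    (M.decomp.symm : _ →ₗ[k] _)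

variable (M : GrMod k n)

lemma proj_mem (j : ℤ) (m : M.carrier) : M.proj j m ∈ M.deg j := by
  simp [proj]

lemma symm_of_mem {i : ℤ} {m : M.carrier} (h : m ∈ M.deg i) :
    M.decomp.symm m = DirectSum.lof k ℤ (fun i => M.deg i) i ⟨m, h⟩ := by
  rw [LinearEquiv.symm_apply_eq, decomp, LinearEquiv.ofBijective_apply,
    DirectSum.coeLinearMap_lof]

lemma proj_of_mem {j : ℤ} {m : M.carrier} (h : m ∈ M.deg j) : M.proj j m = m := by
  simp only [proj, LinearMap.comp_apply, LinearEquiv.coe_coe]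
  rw [symm_of_mem M h, DirectSum.component.lof_self]
  rfl

lemma proj_of_mem_ne {i j : ℤ} (hij : i ≠ j) {m : M.carrier} (h : m ∈ M.deg i) :
    M.proj j m = 0 := by
  simp only [proj, LinearMap.comp_apply, LinearEquiv.coe_coe]
  rw [symm_of_mem M h, DirectSum.component.of, dif_neg hij]
  simp

/-- To prove something linear for all elements, it suffices to do so for homogeneous elements. -/
lemma homog_induction (S : Submodule k M.carrier) (h : ∀ j, M.deg j ≤ S) (m : M.carrier) :
    m ∈ S := by
  have : (⊤ : Submodule k M.carrier) ≤ S := by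
    rw [← M.isInternal.submodule_iSup_eq_top]
    exact iSup_le h
  exact this trivial

lemma exists_sum_proj (m : M.carrier) :
    ∃ s : Finset ℤ, ∀ t : Finset ℤ, s ⊆ t → ∑ j ∈ t, M.proj j m = m := by
  classical
  let S : Submodule k M.carrier :=
    { carrier := {m | ∃ s : Finset ℤ, ∀ t : Finset ℤ, s ⊆ t → ∑ j ∈ t, M.proj j m = m}
      zero_mem' := ⟨∅, fun t _ => by simp⟩
      add_mem' := by
        rintro a b ⟨s, hs⟩ ⟨s', hs'⟩
        refine ⟨s ∪ s', fun t ht => ?_⟩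
        simp only [map_add, Finset.sum_add_distrib]
        rw [hs t (Finset.union_subset_left ht), hs' t (Finset.union_subset_right ht)]
      smul_mem' := by
        rintro c a ⟨s, hs⟩
        refine ⟨s, fun t ht => ?_⟩
        simp only [map_smul, ← Finset.smul_sum]
        rw [hs t ht] }
  refine M.homog_induction S (fun i m hm => ⟨{i}, fun t ht => ?_⟩) m
  rw [Finset.sum_eq_single i, M.proj_of_mem hm]
  · intro j _ hj
    exact M.proj_of_mem_ne (Ne.symm hj) hm
  · intro h
    exact absurd (ht (by simp)) h

lemma eq_zero_of_proj {m : M.carrier} (h : ∀ j, M.proj j m = 0) : m = 0 := by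
  obtain ⟨s, hs⟩ := M.exists_sum_proj m
  rw [← hs s subset_rfl]
  exact Finset.sum_eq_zero fun j _ => h j

lemma lin_proj {M N : GrMod k n} (f : M ⟶ N) (j : ℤ) (m : M.carrier) :
    Hom.lin f (M.proj j m) = N.proj j (Hom.lin f m) := by
  let S : Submodule k M.carrier :=
    LinearMap.eqLocus ((Hom.lin f).restrictScalars k ∘ₗ M.proj j)
      (N.proj j ∘ₗ (Hom.lin f).restrictScalars k)
  refine M.homog_induction S (fun i m hm => ?_) m
  change Hom.lin f (M.proj j m) = N.proj j (Hom.lin f m)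
  by_cases hij : i = j
  · subst hij
    rw [M.proj_of_mem hm, N.proj_of_mem (Hom.map_deg f _ _ hm)]
  · rw [M.proj_of_mem_ne hij hm, N.proj_of_mem_ne hij (Hom.map_deg f _ _ hm), map_zero]

lemma proj_ι_smul (a : Fin (n + 1)) (j : ℤ) (m : M.carrier) :
    M.proj j (FreeAlgebra.ι k a • m) = FreeAlgebra.ι k a • M.proj (j - 1) m := by
  let x : M.carrier →ₗ[k] M.carrier := Module.toModuleEnd k (S := FreeAlg k n) M.carrier (FreeAlgebra.ι k a)
  let S : Submodule k M.carrier :=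
    LinearMap.eqLocus (M.proj j ∘ₗ x) (x ∘ₗ M.proj (j - 1))
  refine M.homog_induction S (fun i m hm => ?_) m
  change M.proj j (FreeAlgebra.ι k a • m) = FreeAlgebra.ι k a • M.proj (j - 1) m
  have hx := M.smul_mem (ι_mem a) hm
  by_cases hij : i = j - 1
  · subst hij
    rw [M.proj_of_mem hm, M.proj_of_mem]
    convert hx using 2; ring
  · rw [M.proj_of_mem_ne hij hm, M.proj_of_mem_ne _ hx, smul_zero]
    omega


/-! #### Constructions of graded modules -/

/-- The twist `M(d)`, with `M(d)ⱼ = M_{d+j}` and the same action of `R`. -/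
def twist (d : ℤ) : GrMod k n where
  carrier := M.carrier
  deg j := M.deg (d + j)
  isInternal := by
    refine isInternal_of_proj _ (fun j => M.proj (d + j)) (fun j m hm => M.proj_of_mem hm)
      (fun i j hij m hm => M.proj_of_mem_ne (by omega) hm) (fun m j => M.proj_mem _ m)
      (fun m => ?_)
    obtain ⟨s, hs⟩ := M.exists_sum_proj m
    refine ⟨s.map ⟨fun j => j - d, fun a b h => by simpa using h⟩, ?_⟩
    rw [Finset.sum_map]
    refine Eq.trans (Finset.sum_congr rfl fun j _ => ?_) (hs s subset_rfl)
    change M.proj (d + (j - d)) m = M.proj j m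
    rw [add_sub_cancel]
  smul_mem {i j a m} ha hm := by
    have := M.smul_mem ha hm
    rwa [show i + (d + j) = d + (i + j) by ring] at this

variable (k n) in
/-- The ring `R` as a graded left module over itself. -/
def self : GrMod k n where
  carrier := FreeAlg k n
  deg := homog k n
  isInternal := homog_isInternal
  smul_mem ha hm := mul_mem_homog ha hm

/-- Finite products of graded modules. -/
def pi {ι : Type} [Finite ι] (M : ι → GrMod k n) : GrMod k n where
  carrier := ∀ i, (M i).carrier
  deg j := Submodule.pi Set.univ fun i => (M i).deg j
  isInternal := by
    classical
    cases nonempty_fintype ι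
    refine isInternal_of_proj _
      (fun j => LinearMap.pi fun i => (M i).proj j ∘ₗ LinearMap.proj i) ?_ ?_ ?_ ?_
    · intro j m hm
      ext i
      exact (M i).proj_of_mem (hm i trivial)
    · intro i j hij m hm
      ext l
      exact (M l).proj_of_mem_ne hij (hm l trivial)
    · intro m j i _
      exact (M i).proj_mem _ _
    · intro m
      choose s hs using fun i => (M i).exists_sum_proj (m i)
      refine ⟨Finset.univ.biUnion s, ?_⟩
      ext i
      simp only [Finset.sum_apply, LinearMap.pi_apply, LinearMap.comp_apply, LinearMap.proj_apply]
      exact hs i _ (Finset.subset_biUnion_of_mem s (Finset.mem_univ i))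
  smul_mem ha hm i _ := (M i).smul_mem ha (hm i trivial)

variable {M} {N : GrMod k n} (f : M ⟶ N)

/-- The kernel of a morphism. -/
def kerObj : GrMod k n where
  carrier := LinearMap.ker (Hom.lin f)
  deg j := (M.deg j).comap ((LinearMap.ker (Hom.lin f)).subtype.restrictScalars k)
  isInternal := by
    refine isInternal_of_proj _
      (fun j => LinearMap.restrict (M.proj j) (p := (LinearMap.ker (Hom.lin f)).restrictScalars k)
        (q := (LinearMap.ker (Hom.lin f)).restrictScalars k) fun m hm => ?_) ?_ ?_ ?_ ?_
    · change Hom.lin f (M.proj j m) = 0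
      rw [lin_proj, show Hom.lin f m = 0 from hm, map_zero]
    · intro j m hm
      exact Subtype.ext (M.proj_of_mem hm)
    · intro i j hij m hm
      exact Subtype.ext (M.proj_of_mem_ne hij hm)
    · intro m j
      exact M.proj_mem _ _
    · intro m
      obtain ⟨s, hs⟩ := M.exists_sum_proj m.1
      refine ⟨s, Subtype.ext ?_⟩
      refine Eq.trans ?_ (hs s subset_rfl)
      exact map_sum ((LinearMap.ker (Hom.lin f)).subtype) _ s
  smul_mem ha hm := M.smul_mem ha hm

/-- The inclusion of the kernel. -/
def kerι : kerObj f ⟶ M where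
  lin := (LinearMap.ker (Hom.lin f)).subtype
  map_deg _ _ h := h

/-- The cokernel of a morphism. -/
def cokerObj : GrMod k n where
  carrier := N.carrier ⧸ LinearMap.range (Hom.lin f)
  deg j := (N.deg j).map ((LinearMap.range (Hom.lin f)).mkQ.restrictScalars k)
  isInternal := by
    refine isInternal_of_proj _
      (fun j => Submodule.mapQ ((LinearMap.range (Hom.lin f)).restrictScalars k)
        ((LinearMap.range (Hom.lin f)).restrictScalars k) (N.proj j) ?_) ?_ ?_ ?_ ?_
    · rintro _ ⟨m, rfl⟩
      exact ⟨M.proj j m, lin_proj f j m⟩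
    · rintro j _ ⟨m, hm, rfl⟩
      exact congrArg (LinearMap.range (Hom.lin f)).mkQ (N.proj_of_mem hm)
    · rintro i j hij _ ⟨m, hm, rfl⟩
      exact (congrArg (LinearMap.range (Hom.lin f)).mkQ (N.proj_of_mem_ne hij hm)).trans
        (map_zero _)
    · intro m j
      obtain ⟨m, rfl⟩ := Submodule.mkQ_surjective _ m
      exact ⟨N.proj j m, N.proj_mem _ _, rfl⟩
    · intro m
      obtain ⟨m, rfl⟩ := Submodule.mkQ_surjective _ m
      obtain ⟨s, hs⟩ := N.exists_sum_proj m
      refine ⟨s, ?_⟩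
      refine Eq.trans ?_ (congrArg (LinearMap.range (Hom.lin f)).mkQ (hs s subset_rfl))
      exact (map_sum ((LinearMap.range (Hom.lin f)).mkQ) _ s).symm
  smul_mem := by
    rintro i j a _ ha ⟨m, hm, rfl⟩
    exact ⟨a • m, N.smul_mem ha hm, rfl⟩

/-- The projection to the cokernel. -/
def cokerπ : N ⟶ cokerObj f where
  lin := (LinearMap.range (Hom.lin f)).mkQ
  map_deg _ m h := ⟨m, h, rfl⟩

lemma kerι_comp : kerι f ≫ f = 0 := by
  apply hom_ext
  ext x
  exact x.2

lemma comp_cokerπ : f ≫ cokerπ f = 0 := by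
  apply hom_ext
  ext x
  exact (Submodule.Quotient.mk_eq_zero _).2 ⟨x, rfl⟩

/-- An injective morphism with image the kernel of `f` is a kernel of `f`. -/
def isLimitOfExact {K : GrMod k n} (i : K ⟶ M) (hi : Function.Injective (Hom.lin i))
    (w : i ≫ f = 0) (h : ∀ m, Hom.lin f m = 0 → ∃ x, Hom.lin i x = m) :
    IsLimit (KernelFork.ofι i w) := by
  have mem : ∀ {W' : GrMod k n} (g : W' ⟶ M), g ≫ f = 0 →
      ∀ x, Hom.lin g x ∈ LinearMap.range (Hom.lin i) := fun g hg x =>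
    h _ (congrArg (fun φ => Hom.lin φ x) hg)
  refine KernelFork.IsLimit.ofι i w
    (fun {W'} g hg => ⟨(LinearEquiv.ofInjective (Hom.lin i) hi).symm.toLinearMap ∘ₗ
      (Hom.lin g).codRestrict _ (mem g hg), ?_⟩) ?_ ?_
  · intro j m hm
    have key : Hom.lin i ((LinearEquiv.ofInjective (Hom.lin i) hi).symm
        ⟨Hom.lin g m, mem g hg m⟩) = Hom.lin g m :=
      congrArg Subtype.val ((LinearEquiv.ofInjective (Hom.lin i) hi).apply_symm_apply _)
    change (LinearEquiv.ofInjective (Hom.lin i) hi).symm ⟨Hom.lin g m, mem g hg m⟩ ∈ K.deg j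
    generalize (LinearEquiv.ofInjective (Hom.lin i) hi).symm ⟨Hom.lin g m, mem g hg m⟩ = y at key
    have : K.proj j y = y := hi (by
      rw [lin_proj, key, M.proj_of_mem (Hom.map_deg g j m hm)])
    rw [← this]
    exact K.proj_mem _ _
  · intro W' g hg
    apply hom_ext
    ext x
    exact congrArg Subtype.val ((LinearEquiv.ofInjective (Hom.lin i) hi).apply_symm_apply
      ⟨Hom.lin g x, mem g hg x⟩)
  · intro W' g hg m hm
    apply hom_ext
    ext x
    apply hi
    refine (congrArg (fun φ => Hom.lin φ x) hm).trans ?_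
    exact (congrArg Subtype.val ((LinearEquiv.ofInjective (Hom.lin i) hi).apply_symm_apply
      ⟨Hom.lin g x, mem g hg x⟩)).symm

/-- A surjective morphism with kernel the image of `f` is a cokernel of `f`. -/
def isColimitOfExact {C : GrMod k n} (p : N ⟶ C) (hp : Function.Surjective (Hom.lin p))
    (w : f ≫ p = 0) (h : ∀ m, Hom.lin p m = 0 → ∃ x, Hom.lin f x = m) :
    IsColimit (CokernelCofork.ofπ p w) := by
  have le : ∀ {W' : GrMod k n} (g : N ⟶ W'), f ≫ g = 0 →
      LinearMap.ker (Hom.lin p) ≤ LinearMap.ker (Hom.lin g) := by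
    intro W' g hg x hx
    obtain ⟨y, rfl⟩ := h x hx
    exact congrArg (fun φ => Hom.lin φ y) hg
  have key : ∀ {W' : GrMod k n} (g : N ⟶ W') (hg : f ≫ g = 0) (x : N.carrier),
      ((LinearMap.ker (Hom.lin p)).liftQ (Hom.lin g) (le g hg) ∘ₗ
        ((Hom.lin p).quotKerEquivOfSurjective hp).symm.toLinearMap) (Hom.lin p x) =
          Hom.lin g x := by
    intro W' g hg x
    have : ((Hom.lin p).quotKerEquivOfSurjective hp).symm (Hom.lin p x) =
        (LinearMap.ker (Hom.lin p)).mkQ x := by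
      rw [LinearEquiv.symm_apply_eq]; rfl
    simp only [LinearMap.comp_apply, LinearEquiv.coe_coe, this]
    rfl
  refine CokernelCofork.IsColimit.ofπ p w
    (fun {W'} g hg => ⟨(LinearMap.ker (Hom.lin p)).liftQ (Hom.lin g) (le g hg) ∘ₗ
      ((Hom.lin p).quotKerEquivOfSurjective hp).symm.toLinearMap, ?_⟩) ?_ ?_
  · intro j m hm
    obtain ⟨x, rfl⟩ := hp m
    have hx : Hom.lin p (N.proj j x) = Hom.lin p x := by
      rw [lin_proj, C.proj_of_mem hm]
    rw [← hx, key g hg]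
    exact Hom.map_deg g j _ (N.proj_mem _ _)
  · intro W' g hg
    apply hom_ext
    ext x
    exact key g hg x
  · intro W' g hg m hm
    apply hom_ext
    ext x
    obtain ⟨x, rfl⟩ := hp x
    refine (congrArg (fun φ => Hom.lin φ x) hm).trans ?_
    exact (key g hg x).symm

/-- The kernel is a kernel. -/
def kerIsLimit : IsLimit (KernelFork.ofι (kerι f) (kerι_comp f)) :=
  isLimitOfExact f _ (Submodule.subtype_injective _) _ fun m hm => ⟨⟨m, hm⟩, rfl⟩

/-- The cokernel is a cokernel. -/
def cokerIsColimit : IsColimit (CokernelCofork.ofπ (cokerπ f) (comp_cokerπ f)) :=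
  isColimitOfExact f _ (Submodule.mkQ_surjective _) _ fun _ hm =>
    (Submodule.Quotient.mk_eq_zero _).1 hm

instance : HasKernels (GrMod k n) where
  has_limit f := ⟨⟨_, kerIsLimit f⟩⟩

instance : HasCokernels (GrMod k n) where
  has_colimit f := ⟨⟨_, cokerIsColimit f⟩⟩

lemma injective_of_mono [Mono f] : Function.Injective (Hom.lin f) := by
  rw [injective_iff_map_eq_zero]
  intro m hm
  have : kerι f = 0 := (cancel_mono f).1 (by rw [kerι_comp, zero_comp])
  exact congrArg (fun φ => Hom.lin φ (⟨m, hm⟩ : LinearMap.ker (Hom.lin f))) this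

lemma surjective_of_epi [Epi f] : Function.Surjective (Hom.lin f) := by
  intro m
  have : cokerπ f = 0 := (cancel_epi f).1 (by rw [comp_cokerπ, comp_zero])
  exact (Submodule.Quotient.mk_eq_zero _).1 (congrArg (fun φ => Hom.lin φ m) this)

instance : IsNormalMonoCategory (GrMod k n) where
  normalMonoOfMono f _ := ⟨{
    Z := cokerObj f
    g := cokerπ f
    w := comp_cokerπ f
    isLimit := isLimitOfExact (cokerπ f) f (injective_of_mono f) _ fun _ hm =>
      (Submodule.Quotient.mk_eq_zero _).1 hm }⟩

instance : IsNormalEpiCategory (GrMod k n) where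
  normalEpiOfEpi f _ := ⟨{
    W := kerObj f
    g := kerι f
    w := kerι_comp f
    isColimit := isColimitOfExact (kerι f) f (surjective_of_epi f) _ fun m hm =>
      ⟨⟨m, hm⟩, rfl⟩ }⟩

/-- The projections from a finite product. -/
def piProj {ι : Type} [Finite ι] (M : ι → GrMod k n) (i : ι) : pi M ⟶ M i where
  lin := LinearMap.proj i
  map_deg _ _ h := h i trivial

/-- `pi M` is a product. -/
def piIsLimit {ι : Type} [Finite ι] (M : ι → GrMod k n) :
    IsLimit (Fan.mk (pi M) (piProj M)) :=
  Fan.IsLimit.mk _ (fun s => ⟨LinearMap.pi fun i => Hom.lin (s.proj i),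
      fun j m hm i _ => Hom.map_deg (s.proj i) j m hm⟩)
    (fun _ _ => rfl)
    (fun s m hm => by
      apply hom_ext
      ext x
      funext i
      exact congrArg (fun φ => Hom.lin φ x) (hm i))

instance {ι : Type} [Finite ι] (M : ι → GrMod k n) : HasProduct M := ⟨⟨_, piIsLimit M⟩⟩

instance : HasFiniteProducts (GrMod k n) :=
  ⟨fun _ => ⟨fun _ => hasLimit_of_iso Discrete.natIsoFunctor.symm⟩⟩

/-- The category of graded `R`-modules is abelian. -/
instance : Abelian (GrMod k n) where

end GrMod

end GrMod

/-! ### The free algebra is graded coherent -/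

section Coherent

variable {k : Type u} [Field k] {n : ℕ}

section Act

variable (k) (M : Type*) [AddCommGroup M] [Module k M] [Module (FreeAlg k n) M]
  [IsScalarTower k (FreeAlg k n) M]

/-- The map `M^{n+1} → M`, `(m₀, …, mₙ) ↦ ∑ xₐ mₐ`. -/
def act : (Fin (n + 1) → M) →ₗ[k] M :=
  ∑ a, Module.toModuleEnd k (S := FreeAlg k n) M (FreeAlgebra.ι k a) ∘ₗ LinearMap.proj a

variable {M}

lemma act_apply (v : Fin (n + 1) → M) : act k M v = ∑ a, FreeAlgebra.ι k a • v a := by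
  simp [act]

variable {k}

lemma ι_smul_mem_range_act (a : Fin (n + 1)) (m : M) :
    FreeAlgebra.ι k a • m ∈ LinearMap.range (act (n := n) k M) := by
  classical
  refine ⟨Pi.single a m, ?_⟩
  rw [act_apply, Finset.sum_eq_single a]
  · simp
  · intro b _ hb; simp [hb]
  · simp

lemma map_act {N : Type*} [AddCommGroup N] [Module k N] [Module (FreeAlg k n) N]
    [IsScalarTower k (FreeAlg k n) N] (f : M →ₗ[FreeAlg k n] N) (v : Fin (n + 1) → M) :
    f (act k M v) = act k N (fun a => f (v a)) := by
  simp [act_apply]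

/-- `R = k + ∑ xₐ R`. -/
lemma smul_mem_of_mem {T : Submodule k M} (hT : LinearMap.range (act (n := n) k M) ≤ T)
    (r : FreeAlg k n) {m : M} (hm : m ∈ T) : r • m ∈ T := by
  have hr : r ∈ Submodule.span k (Set.range (monom k (n := n))) := by
    rw [span_monom]; trivial
  induction hr using Submodule.span_induction with
  | mem x hx =>
    obtain ⟨w, rfl⟩ := hx
    cases w with
    | nil => simpa [monom_nil] using hm
    | cons a w =>
      rw [monom_cons, mul_smul]
      exact hT (ι_smul_mem_range_act a _)
  | zero => simp
  | add x y _ _ hx hy => rw [add_smul]; exact add_mem hx hy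
  | smul c x _ hx => rw [smul_assoc]; exact T.smul_mem c hx

variable (M) in
lemma finite_coker_act [Module.Finite (FreeAlg k n) M] :
    Module.Finite k (M ⧸ LinearMap.range (act (n := n) k M)) := by
  obtain ⟨S, hS⟩ := Module.Finite.fg_top (R := FreeAlg k n) (M := M)
  have h : Submodule.span k (S : Set M) ⊔ LinearMap.range (act (n := n) k M) = ⊤ := by
    refine eq_top_iff.2 fun m _ => ?_
    have hm : m ∈ Submodule.span (FreeAlg k n) (S : Set M) := by rw [hS]; trivial
    induction hm using Submodule.span_induction with
    | mem x hx => exact Submodule.mem_sup_left (Submodule.subset_span hx)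
    | zero => exact zero_mem _
    | add x y _ _ hx hy => exact add_mem (hx trivial) (hy trivial)
    | smul r x _ hx => exact smul_mem_of_mem le_sup_right r (hx trivial)
  have : Submodule.map (LinearMap.range (act (n := n) k M)).mkQ (Submodule.span k (S : Set M)) =
      ⊤ := by
    rw [Submodule.map_mkQ_eq_top, sup_comm]
    exact h
  exact ⟨this ▸ (Submodule.fg_span S.finite_toSet).map _⟩

/-- Left division by `xₐ`. -/
def leftDiv (a : Fin (n + 1)) : FreeAlg k n →ₗ[k] FreeAlg k n :=
  monomLift fun w => match w with
    | [] => 0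
    | b :: w => if b = a then monom k w else 0

lemma leftDiv_ι_mul (a b : Fin (n + 1)) (r : FreeAlg k n) :
    leftDiv a (FreeAlgebra.ι k b * r) = if b = a then r else 0 := by
  have : leftDiv a ∘ₗ LinearMap.mulLeft k (FreeAlgebra.ι k b) =
      if b = a then LinearMap.id else 0 := by
    apply monom_ext
    intro w
    simp only [LinearMap.comp_apply, LinearMap.mulLeft_apply, ← monom_cons]
    rw [leftDiv, monomLift_monom]
    by_cases hba : b = a <;> simp [hba]
  have h := congrArg (fun f => f r) this
  simp only [LinearMap.comp_apply, LinearMap.mulLeft_apply] at h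
  rw [h]; split_ifs <;> rfl

lemma act_injective (ι : Type*) : Function.Injective (act (n := n) k (ι → FreeAlg k n)) := by
  rw [injective_iff_map_eq_zero]
  intro v hv
  funext a i
  have h : leftDiv a (act k (ι → FreeAlg k n) v i) = v a i := by
    rw [act_apply]
    simp [leftDiv_ι_mul]
  rw [← h, hv]
  simp

lemma finite_range_of_ker_le {U A Q : Type*} [AddCommGroup U] [Module k U] [AddCommGroup A]
    [Module k A] [AddCommGroup Q] [Module k Q] [Module.Finite k A] (h : U →ₗ[k] A)
    (g : U →ₗ[k] Q) (hle : LinearMap.ker h ≤ LinearMap.ker g) :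
    Module.Finite k (LinearMap.range g) := by
  have : Module.Finite k (U ⧸ LinearMap.ker h) :=
    Module.Finite.equiv h.quotKerEquivRange.symm
  have e : LinearMap.range ((LinearMap.ker h).liftQ g hle) = LinearMap.range g :=
    Submodule.range_liftQ _ _ _
  rw [← e]
  infer_instance

variable (M) in
lemma finite_ker_act [Module.FinitePresentation (FreeAlg k n) M] :
    Module.Finite k (LinearMap.ker (act (n := n) k M)) := by
  obtain ⟨s, π, hπ⟩ := Module.Finite.exists_fin' (FreeAlg k n) M
  have hL : (LinearMap.ker π).FG := Module.FinitePresentation.fg_ker π hπ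
  have : Module.Finite (FreeAlg k n) (LinearMap.ker π) := Module.Finite.of_fg hL
  have := finite_coker_act (k := k) (n := n) (LinearMap.ker π)
  obtain ⟨σ, hσ⟩ := (π.restrictScalars k).exists_rightInverse_of_surjective
    (LinearMap.range_eq_top.2 hπ)
  have hσ' : ∀ m, π (σ m) = m := fun m => congrArg (fun f => f m) hσ
  let F : Type _ := Fin s → FreeAlg k n
  let σ' : (Fin (n + 1) → M) →ₗ[k] (Fin (n + 1) → F) := σ.compLeft (Fin (n + 1))
  have hmem : ∀ v : LinearMap.ker (act (n := n) k M), act k F (σ' v.1) ∈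
      (LinearMap.ker π).restrictScalars k := by
    intro v
    change π (act k F (σ' v.1)) = 0
    rw [map_act]
    refine Eq.trans ?_ v.2
    congr 1
    funext a
    exact hσ' _
  let g : LinearMap.ker (act (n := n) k M) →ₗ[k] (LinearMap.ker π) :=
    LinearMap.codRestrict ((LinearMap.ker π).restrictScalars k)
      (act k F ∘ₗ σ' ∘ₗ (LinearMap.ker (act (n := n) k M)).subtype) hmem
  refine Module.Finite.of_injective
    ((LinearMap.range (act (n := n) k (LinearMap.ker π))).mkQ ∘ₗ g) ?_
  rw [injective_iff_map_eq_zero]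
  intro v hv
  obtain ⟨l, hl⟩ := (Submodule.Quotient.mk_eq_zero _).1 hv
  have h1 : act k F (fun a => (l a : F)) = act k F (σ' v.1) := by
    refine (map_act (LinearMap.ker π).subtype l).symm.trans ?_
    rw [hl]
    rfl
  have h2 := act_injective _ h1
  apply Subtype.ext
  funext a
  rw [← hσ' (v.1 a)]
  have h3 : σ (v.1 a) = (l a : F) := (congrFun h2 a).symm
  rw [h3]
  exact (l a).2

lemma finite_coker_act_ker {N : Type*} [AddCommGroup N] [Module k N] [Module (FreeAlg k n) N]
    [IsScalarTower k (FreeAlg k n) N] (f : M →ₗ[FreeAlg k n] N)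
    [Module.Finite k (M ⧸ LinearMap.range (act (n := n) k M))]
    [Module.Finite k (LinearMap.ker (act (n := n) k N))] :
    Module.Finite k
      (LinearMap.ker f ⧸ LinearMap.range (act (n := n) k (LinearMap.ker f))) := by
  let K := LinearMap.ker f
  let Q := K ⧸ LinearMap.range (act (n := n) k K)
  let U : Submodule k (Fin (n + 1) → M) := (K.restrictScalars k).comap (act k M)
  let h : U →ₗ[k] LinearMap.ker (act (n := n) k N) :=
    LinearMap.codRestrict _ ((f.restrictScalars k).compLeft (Fin (n + 1)) ∘ₗ U.subtype) (by
      intro v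
      have := v.2
      change act k N (fun a => f (v.1 a)) = 0
      rw [← map_act]
      exact v.2)
  let g : U →ₗ[k] Q := (LinearMap.range (act (n := n) k K)).mkQ ∘ₗ
    LinearMap.codRestrict (K.restrictScalars k) (act k M ∘ₗ U.subtype) (fun v => v.2)
  have hgfin : Module.Finite k (LinearMap.range g) := by
    refine finite_range_of_ker_le h g fun v hv => ?_
    have hv' : ∀ a, v.1 a ∈ K := fun a => congrFun (congrArg Subtype.val hv) a
    refine (Submodule.Quotient.mk_eq_zero _).2 ⟨fun a => ⟨v.1 a, hv' a⟩, ?_⟩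
    apply Subtype.ext
    exact map_act K.subtype (fun a => ⟨v.1 a, hv' a⟩ : Fin (n + 1) → K)
  let q : Q →ₗ[k] M ⧸ LinearMap.range (act (n := n) k M) :=
    Submodule.mapQ _ _ (K.subtype.restrictScalars k) (by
      rintro _ ⟨v, rfl⟩
      exact ⟨_, (map_act K.subtype v).symm⟩)
  have hle : LinearMap.ker q ≤ LinearMap.range g := by
    intro x hx
    obtain ⟨x, rfl⟩ := Submodule.mkQ_surjective _ x
    obtain ⟨v, hv⟩ := (Submodule.Quotient.mk_eq_zero _).1 hx
    have hvU : v ∈ U := by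
      change act k M v ∈ K
      rw [hv]; exact x.2
    refine ⟨⟨v, hvU⟩, ?_⟩
    change (LinearMap.range (act (n := n) k K)).mkQ _ = _
    congr 1
    exact Subtype.ext hv
  have : Module.Finite k (LinearMap.ker q) :=
    Module.Finite.of_injective (Submodule.inclusion hle) (Submodule.inclusion_injective hle)
  have : Module.Finite k (Q ⧸ LinearMap.ker q) :=
    Module.Finite.equiv q.quotKerEquivRange.symm
  exact Module.Finite.of_submodule_quotient (LinearMap.ker q)

end Act

namespace GrMod

lemma proj_act (M : GrMod k n) (j : ℤ) (v : Fin (n + 1) → M.carrier) :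
    M.proj j (act k M.carrier v) = act k M.carrier fun a => M.proj (j - 1) (v a) := by
  simp [act_apply, proj_ι_smul]

/-- A finitely generated graded module is bounded below. -/
lemma exists_bound (M : GrMod k n) [Module.Finite (FreeAlg k n) M.carrier] :
    ∃ d : ℤ, ∀ j < d, M.deg j = ⊥ := by
  classical
  obtain ⟨S, hS⟩ := Module.Finite.fg_top (R := FreeAlg k n) (M := M.carrier)
  choose t ht using M.exists_sum_proj
  obtain ⟨d, hd⟩ : ∃ d : ℤ, ∀ j ∈ S.biUnion t, d ≤ j := by
    obtain ⟨d, hd⟩ := (S.biUnion t).bddBelow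
    exact ⟨d, fun j hj => hd hj⟩
  let B : Submodule k M.carrier := ⨅ j : Set.Iio d, LinearMap.ker (M.proj j)
  have hB : ∀ m, m ∈ B ↔ ∀ j < d, M.proj j m = 0 := by
    intro m
    simp [B, Submodule.mem_iInf]
  have hsmul : ∀ (r : FreeAlg k n) (m : M.carrier), m ∈ B → r • m ∈ B := by
    intro r
    induction r using FreeAlgebra.induction with
    | grade0 c => intro m hm; rw [algebraMap_smul]; exact B.smul_mem c hm
    | grade1 a =>
      intro m hm
      rw [hB] at hm ⊢
      intro j hj
      rw [proj_ι_smul, hm _ (by omega), smul_zero]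
    | mul a b ha hb => intro m hm; rw [mul_smul]; exact ha _ (hb m hm)
    | add a b ha hb => intro m hm; rw [add_smul]; exact add_mem (ha m hm) (hb m hm)
  have hall : ∀ m, m ∈ B := by
    intro m
    have hm : m ∈ Submodule.span (FreeAlg k n) (S : Set M.carrier) := by rw [hS]; trivial
    induction hm using Submodule.span_induction with
    | mem x hx =>
      rw [hB]
      intro j hj
      rw [← ht x _ subset_rfl, map_sum]
      refine Finset.sum_eq_zero fun i hi => M.proj_of_mem_ne ?_ (M.proj_mem i x)
      have := hd i (Finset.mem_biUnion.2 ⟨x, hx, hi⟩)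
      omega
    | zero => exact zero_mem _
    | add x y _ _ hx hy => exact add_mem hx hy
    | smul r x _ hx => exact hsmul r x hx
  refine ⟨d, fun j hj => (Submodule.eq_bot_iff _).2 fun m hm => ?_⟩
  rw [← M.proj_of_mem hm]
  exact (hB m).1 (hall m) j hj

/-- Homogeneous generators from a bound on `M / ∑ xₐ M` (graded Nakayama lemma). -/
lemma exists_generators (M : GrMod k n) (d : ℤ) (hd : ∀ j < d, M.deg j = ⊥)
    [Module.Finite k (M.carrier ⧸ LinearMap.range (act (n := n) k M.carrier))] :
    ∃ (s : ℕ) (e : Fin s → ℤ) (g : Fin s → M.carrier), (∀ i, g i ∈ M.deg (e i)) ∧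
      Submodule.span (FreeAlg k n) (Set.range g) = ⊤ := by
  classical
  obtain ⟨S, hS⟩ := Module.Finite.fg_top (R := k)
    (M := M.carrier ⧸ LinearMap.range (act (n := n) k M.carrier))
  choose l hl using Submodule.mkQ_surjective (LinearMap.range (act (n := n) k M.carrier))
  choose t ht using M.exists_sum_proj
  let T : Finset (ℤ × M.carrier) :=
    S.biUnion fun x => (t (l x)).image fun j => (j, M.proj j (l x))
  have hT : ∀ x ∈ T, x.2 ∈ M.deg x.1 := by
    intro x hx
    simp only [T, Finset.mem_biUnion, Finset.mem_image] at hx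
    obtain ⟨y, _, j, _, rfl⟩ := hx
    exact M.proj_mem _ _
  let W : Submodule k M.carrier := Submodule.span k (Prod.snd '' (T : Set (ℤ × M.carrier)))
  have hWproj : ∀ j, ∀ m ∈ W, M.proj j m ∈ W := by
    intro j
    change W ≤ W.comap (M.proj j)
    refine Submodule.span_le.2 ?_
    rintro _ ⟨x, hx, rfl⟩
    change M.proj j x.2 ∈ W
    by_cases hxj : x.1 = j
    · rw [M.proj_of_mem (hxj ▸ hT x hx)]
      exact Submodule.subset_span ⟨x, hx, rfl⟩
    · rw [M.proj_of_mem_ne hxj (hT x hx)]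
      exact zero_mem _
  have hWtop : ∀ m, ∃ w ∈ W, ∃ v : Fin (n + 1) → M.carrier, m = w + act k M.carrier v := by
    have hmap : W.map (LinearMap.range (act (n := n) k M.carrier)).mkQ = ⊤ := by
      rw [eq_top_iff, ← hS]
      refine Submodule.span_le.2 fun x hx => ⟨l x, ?_, hl x⟩
      rw [← ht (l x) _ subset_rfl]
      refine Submodule.sum_mem _ fun j hj => Submodule.subset_span ⟨(j, M.proj j (l x)), ?_, rfl⟩
      exact Finset.mem_biUnion.2 ⟨x, hx, Finset.mem_image.2 ⟨j, hj, rfl⟩⟩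
    intro m
    have : (LinearMap.range (act (n := n) k M.carrier)).mkQ m ∈
      W.map (LinearMap.range (act (n := n) k M.carrier)).mkQ := by rw [hmap]; trivial
    obtain ⟨w, hw, hwm⟩ := this
    obtain ⟨v, hv⟩ := (Submodule.Quotient.eq _).1 hwm.symm
    exact ⟨w, hw, v, by rw [hv]; abel⟩
  let e := T.equivFin
  refine ⟨T.card, fun i => (e.symm i).1.1, fun i => (e.symm i).1.2, fun i => hT _ (e.symm i).2, ?_⟩
  set P : Submodule (FreeAlg k n) M.carrier :=
    Submodule.span (FreeAlg k n) (Set.range fun i => (e.symm i).1.2) with hP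
  have hWP : W ≤ P.restrictScalars k := by
    refine Submodule.span_le.2 ?_
    rintro _ ⟨x, hx, rfl⟩
    exact Submodule.subset_span ⟨e ⟨x, hx⟩, by simp⟩
  have hdeg : ∀ (q : ℕ) (j : ℤ), j < d + q → M.deg j ≤ P.restrictScalars k := by
    intro q
    induction q with
    | zero => intro j hj; rw [hd j (by simpa using hj)]; exact bot_le
    | succ q ih =>
      intro j hj m hm
      obtain ⟨w, hw, v, hv⟩ := hWtop m
      rw [← M.proj_of_mem hm, hv, map_add, proj_act]
      refine add_mem (hWP (hWproj j w hw)) ?_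
      rw [act_apply]
      refine Submodule.sum_mem _ fun a _ => P.smul_mem _ ?_
      exact ih (j - 1) (by push_cast at hj; omega) (M.proj_mem _ _)
  refine eq_top_iff.2 fun m _ => ?_
  exact M.homog_induction (P.restrictScalars k)
    (fun j => hdeg (j - d + 1).toNat j (by omega)) m

/-- The morphism from a finite graded free module given by homogeneous elements. -/
def freeHom (M : GrMod k n) {s : ℕ} (e : Fin s → ℤ) (g : Fin s → M.carrier)
    (hg : ∀ i, g i ∈ M.deg (e i)) : pi (fun i => (self k n).twist (-e i)) ⟶ M where
  lin := Fintype.linearCombination (FreeAlg k n) (M := M.carrier) g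
  map_deg j v hv := by
    change ∑ i, (show FreeAlg k n from v i) • g i ∈ M.deg j
    refine Submodule.sum_mem _ fun i _ => ?_
    have := M.smul_mem (show (show FreeAlg k n from v i) ∈ homog k n (-e i + j)
      from hv i trivial) (hg i)
    rwa [show -e i + j + e i = j by ring] at this

lemma kerObj_deg_eq_bot {M N : GrMod k n} (f : M ⟶ N) {j : ℤ} (h : M.deg j = ⊥) :
    (kerObj f).deg j = ⊥ := by
  refine (Submodule.eq_bot_iff _).2 fun m hm => Subtype.ext ?_
  have hm' : Hom.lin (kerι f) m ∈ M.deg j := Hom.map_deg (kerι f) j m hm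
  rw [h] at hm'
  exact hm'

/-- Kernels of morphisms between finitely presented graded modules are finitely presented. -/
lemma finitePresentation_ker {M N : GrMod k n} (f : M ⟶ N)
    [Module.FinitePresentation (FreeAlg k n) M.carrier]
    [Module.FinitePresentation (FreeAlg k n) N.carrier] :
    Module.FinitePresentation (FreeAlg k n) (kerObj f).carrier := by
  have := finite_coker_act (k := k) (n := n) M.carrier
  have := finite_ker_act (k := k) (n := n) M.carrier
  have := finite_ker_act (k := k) (n := n) N.carrier
  have hK : Module.Finite k ((kerObj f).carrier ⧸
    LinearMap.range (act (n := n) k (kerObj f).carrier)) := finite_coker_act_ker (Hom.lin f)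
  have hker : Module.Finite k (LinearMap.ker (act (n := n) k (kerObj f).carrier)) := by
    let φ : (Fin (n + 1) → (kerObj f).carrier) →ₗ[k] (Fin (n + 1) → M.carrier) :=
      ((LinearMap.ker (Hom.lin f)).subtype.restrictScalars k).compLeft (Fin (n + 1))
    have hφ : Function.Injective φ := fun v w h => by
      funext a
      exact Subtype.ext (congrFun h a)
    refine Module.Finite.of_injective (φ.restrict (p := LinearMap.ker (act (n := n) k _))
      (q := LinearMap.ker (act (n := n) k M.carrier)) ?_) ?_
    · intro v hv
      have := map_act (Hom.lin (kerι f)) v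
      rw [show act k _ v = 0 from hv, map_zero] at this
      exact this.symm
    · intro v w h
      exact Subtype.ext (hφ (congrArg Subtype.val h))
  obtain ⟨d, hd⟩ := M.exists_bound
  obtain ⟨s, e, g, hg, hspan⟩ := (kerObj f).exists_generators d fun j hj => kerObj_deg_eq_bot f (hd j hj)
  let F : GrMod k n := pi (fun i => (self k n).twist (-e i))
  let π : F ⟶ kerObj f := (kerObj f).freeHom e g hg
  have hπ : Function.Surjective (Hom.lin π) := by
    rw [← LinearMap.range_eq_top, ← hspan]
    exact Fintype.range_linearCombination _ _
  have hFp : Module.FinitePresentation (FreeAlg k n) F.carrier :=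
    inferInstanceAs (Module.FinitePresentation (FreeAlg k n) (Fin s → FreeAlg k n))
  have := finite_coker_act (k := k) (n := n) F.carrier
  have hL : Module.Finite k ((kerObj π).carrier ⧸
    LinearMap.range (act (n := n) k (kerObj π).carrier)) := finite_coker_act_ker (Hom.lin π)
  obtain ⟨d', hd'⟩ := F.exists_bound
  obtain ⟨s', e', g', hg', hspan'⟩ := (kerObj π).exists_generators d' fun j hj => kerObj_deg_eq_bot π (hd' j hj)
  have hLfin : Module.Finite (FreeAlg k n) (kerObj π).carrier :=
    ⟨⟨(Set.finite_range g').toFinset, by rw [Set.Finite.coe_toFinset]; exact hspan'⟩⟩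
  exact Module.finitePresentation_of_surjective (Hom.lin π) hπ (Module.Finite.iff_fg.1 hLfin)

end GrMod

end Coherent

/-! ### Coherent sheaves -/

section Coh

variable (k : Type u) [Field k] (n : ℕ)

/-- The finitely presented graded modules. -/
def isFinPres : ObjectProperty (GrMod k n) :=
  fun M => Module.FinitePresentation (FreeAlg k n) M.carrier

/-- The finite dimensional graded modules. -/
def isFinDim : ObjectProperty (GrMod k n) :=
  fun M => FiniteDimensional k M.carrier

variable {k n}

/-- An isomorphism of graded modules is in particular a linear isomorphism. -/
def GrMod.isoLin {M N : GrMod k n} (e : M ≅ N) : M.carrier ≃ₗ[FreeAlg k n] N.carrier :=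
  LinearEquiv.ofLinearMap (GrMod.Hom.lin e.hom) (GrMod.Hom.lin e.inv)
    (congrArg GrMod.Hom.lin e.inv_hom_id) (congrArg GrMod.Hom.lin e.hom_inv_id)

instance : (isFinPres k n).IsClosedUnderIsomorphisms where
  of_iso e h :=
    have : Module.FinitePresentation (FreeAlg k n) _ := h
    Module.FinitePresentation.of_equiv (GrMod.isoLin e)

instance : (isFinPres k n).IsClosedUnderKernels where
  kernels_le := by
    rintro _ ⟨f, c, hc, hf₁, hf₂⟩
    have : Module.FinitePresentation (FreeAlg k n) _ := hf₁
    have : Module.FinitePresentation (FreeAlg k n) _ := hf₂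
    exact (isFinPres k n).prop_of_iso
      (IsLimit.conePointUniqueUpToIso (GrMod.kerIsLimit f) hc) (GrMod.finitePresentation_ker f)

instance : (isFinPres k n).IsClosedUnderCokernels where
  cokernels_le := by
    rintro _ ⟨f, c, hc, hf₁, hf₂⟩
    have : Module.FinitePresentation (FreeAlg k n) _ := hf₁
    have : Module.FinitePresentation (FreeAlg k n) _ := hf₂
    refine (isFinPres k n).prop_of_iso
      (IsColimit.coconePointUniqueUpToIso (GrMod.cokerIsColimit f) hc) ?_
    have hfg : (LinearMap.ker (LinearMap.range (GrMod.Hom.lin f)).mkQ).FG := by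
      rw [Submodule.ker_mkQ]
      exact Module.Finite.iff_fg.1 inferInstance
    exact Module.finitePresentation_of_surjective (LinearMap.range (GrMod.Hom.lin f)).mkQ
      (Submodule.mkQ_surjective _) hfg

instance : (isFinPres k n).IsClosedUnderFiniteProducts where
  isClosedUnderLimitsOfShape J _ := by
    refine .mk' ?_
    rintro _ ⟨F, hF⟩
    have (i : J) : Module.FinitePresentation (FreeAlg k n) (F.obj ⟨i⟩).carrier := hF ⟨i⟩
    have h : Module.FinitePresentation (FreeAlg k n) (∀ i : J, (F.obj ⟨i⟩).carrier) :=
      Module.FinitePresentation.pi _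
    exact (isFinPres k n).prop_of_iso
      (IsLimit.conePointsIsoOfNatIso (GrMod.piIsLimit fun i : J => F.obj ⟨i⟩) (limit.isLimit F)
        Discrete.natIsoFunctor.symm) h

variable (k n) in
/-- The zero graded module. -/
def GrMod.zeroObj : GrMod k n := GrMod.pi (fun i : Fin 0 => i.elim0)

instance : Subsingleton (GrMod.zeroObj k n).carrier :=
  inferInstanceAs (Subsingleton (∀ i : Fin 0, (i.elim0 : GrMod k n).carrier))

lemma GrMod.isZero_zeroObj : IsZero (GrMod.zeroObj k n) := by
  rw [IsZero.iff_id_eq_zero]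
  apply GrMod.hom_ext
  exact LinearMap.ext fun x => Subsingleton.elim _ _

instance : (isFinPres k n).ContainsZero where
  exists_zero := ⟨_, GrMod.isZero_zeroObj, Module.FinitePresentation.of_subsingleton _⟩

instance : (isFinDim k n).IsSerreClass where
  exists_zero := ⟨_, GrMod.isZero_zeroObj, Module.Finite.of_finite⟩
  prop_of_mono f _ h :=
    have : Module.Finite k _ := h
    Module.Finite.of_injective ((GrMod.Hom.lin f).restrictScalars k) (GrMod.injective_of_mono f)
  prop_of_epi f _ h :=
    have : Module.Finite k _ := h
    Module.Finite.of_surjective ((GrMod.Hom.lin f).restrictScalars k) (GrMod.surjective_of_epi f)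
  prop_X₂_of_shortExact := by
    intro S hS h₁ h₃
    have : Module.Finite k S.X₁.carrier := h₁
    have : Module.Finite k S.X₃.carrier := h₃
    let g := (GrMod.Hom.lin S.g).restrictScalars k
    let e : S.X₁ ≅ GrMod.kerObj S.g :=
      IsLimit.conePointUniqueUpToIso hS.fIsKernel (GrMod.kerIsLimit S.g)
    have : Module.Finite k (LinearMap.ker g) :=
      Module.Finite.equiv ((GrMod.isoLin e).restrictScalars k)
    have : Module.Finite k (S.X₂.carrier ⧸ LinearMap.ker g) :=
      Module.Finite.equiv g.quotKerEquivRange.symm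
    exact Module.Finite.of_submodule_quotient (LinearMap.ker g)

variable (k n) in
/-- The category `gr R` of finitely presented graded `R`-modules. -/
abbrev FpGr : Type (u + 1) := (isFinPres k n).FullSubcategory

variable (k n) in
/-- The full subcategory `fdim R` of `gr R` of finite dimensional modules. -/
def fdim : ObjectProperty (FpGr k n) := (isFinDim k n).inverseImage (isFinPres k n).ι

instance : PreservesFiniteLimits (isFinPres k n).ι := by
  have := fun {X Y : FpGr k n} (f : X ⟶ Y) => (isFinPres k n).preservesKernels_ι f
  exact Functor.preservesFiniteLimits_of_preservesKernels _

instance : PreservesFiniteColimits (isFinPres k n).ι := by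
  have := fun {X Y : FpGr k n} (f : X ⟶ Y) => (isFinPres k n).preservesCokernels_ι f
  exact Functor.preservesFiniteColimits_of_preservesCokernels _

instance : (fdim k n).IsSerreClass := by
  unfold fdim; infer_instance

variable (k n) in
/-- The category `coh 𝕏ⁿ = qgr R = gr R / fdim R`: the localization of `gr R` at the morphisms
whose kernel and cokernel are finite dimensional. -/
abbrev Coh : Type (u + 1) := (fdim k n).isoModSerre.Localization

variable (k n) in
/-- The quotient functor `π^* : gr R → qgr R`. -/
abbrev quot : FpGr k n ⥤ Coh k n := (fdim k n).isoModSerre.Q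

instance : Abelian (Coh k n) :=
  ObjectProperty.SerreClassLocalization.abelian (quot k n) (fdim k n)

instance : HasFiniteBiproducts (Coh k n) := Abelian.hasFiniteBiproducts

variable (k n) in
/-- The graded module `R(i)`, as an object of `gr R`. -/
def selfTwist (i : ℤ) : FpGr k n :=
  ⟨(GrMod.self k n).twist i,
    inferInstanceAs (Module.FinitePresentation (FreeAlg k n) (FreeAlg k n))⟩

variable (k n) in
/-- The object `𝒪(i) = π^*(R(i))` of `coh 𝕏ⁿ`. -/
def structureSheaf (i : ℤ) : Coh k n := (quot k n).obj (selfTwist k n i)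

end Coh

/-! ### Grothendieck groups -/

section K0

universe v w

variable (C : Type w) [Category.{v} C] [Abelian C]

/-- The subgroup of the free abelian group on the objects generated by `[X₂] - [X₁] - [X₃]` for all
short exact sequences `0 → X₁ → X₂ → X₃ → 0`. -/
def K0Relations : AddSubgroup (FreeAbelianGroup C) :=
  AddSubgroup.closure {x | ∃ S : ShortComplex C, S.ShortExact ∧
    x = FreeAbelianGroup.of S.X₂ - FreeAbelianGroup.of S.X₁ - FreeAbelianGroup.of S.X₃}

/-- The Grothendieck group of an abelian category. -/
abbrev K0 : Type w := FreeAbelianGroup C ⧸ K0Relations C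

variable {C} in
/-- The class of an object in the Grothendieck group. -/
def K0.of (X : C) : K0 C := QuotientAddGroup.mk (FreeAbelianGroup.of X)

end K0

end FreeProj

end

noncomputable section

universe u

namespace FreeProj

/-! ### Finitely presented graded modules in large degrees -/

section LargeDegree

variable {k : Type u} [Field k] {n : ℕ}

namespace GrMod

variable (M : GrMod k n)

/-! For a finitely presented graded module `M`, the map `M^{n+1} → M`, `(mₐ) ↦ ∑ xₐ mₐ`, has finite
dimensional cokernel (finite generation) and finite dimensional kernel (finite presentation). Hence
`M_j^{n+1} ≅ M_{j+1}` for all large `j`: above a large degree `d`, the module `M` is free on a basis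
of `M_d`. The resulting map `R(-d)^r → M`, with `r = dim M_d`, has finite dimensional kernel and
cokernel and becomes invertible in the quotient (`exists_freeHom_bijective`,
`exists_isoModSerre_free`). So every object is some `𝒪(-d)^r`; and since this map also lifts along
every epimorphism onto `M` in `gr R`, epimorphisms of the quotient split (`exists_section_of_epi`).

The same isomorphisms give `dim M_d = q (n+1)^d` for large `d`. The number `q` depends only on the
image of `M` in the quotient and is additive on direct sums; it is the `rank`. As `𝒪(-d)^r` has rank
`r (n+1)^{-d}` and any two objects can be written with a common `d`, rank determines an object up to
isomorphism (`nonempty_iso_of_rank_eq`).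

Everything else follows from this. Raising `d` by one multiplies `r` by `n + 1 ≥ 2`, so a nonzero
object is a sum of arbitrarily many nonzero summands. This excludes indecomposable and simple
objects and makes the spaces of morphisms infinite dimensional. A nonzero noetherian object would
have a quotient by a maximal proper subobject, which could not decompose. Finally, rank is additive
on the (split) short exact sequences and identifies `K₀` with `ℤ[1/(n+1)]`. -/

lemma exists_proj_eq_zero_of_fg (W : Submodule k M.carrier) (hW : W.FG) :
    ∃ d : ℤ, ∀ j, d ≤ j → ∀ m ∈ W, M.proj j m = 0 := by
  classical
  obtain ⟨S, rfl⟩ := hW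
  choose t ht using M.exists_sum_proj
  obtain ⟨d, hd⟩ := (S.biUnion t).bddAbove
  -- `d` bounds the degrees of all homogeneous components of the finitely many generators, and may
  -- itself occur.
  refine ⟨d + 1, fun j hj => ?_⟩
  change Submodule.span k (S : Set M.carrier) ≤ LinearMap.ker (M.proj j)
  refine Submodule.span_le.2 fun x hx => ?_
  change M.proj j x = 0
  rw [← ht x _ subset_rfl, map_sum]
  refine Finset.sum_eq_zero fun i hi => M.proj_of_mem_ne ?_ (M.proj_mem i x)
  have : i ≤ d := hd (Finset.mem_coe.2 (Finset.mem_biUnion.2 ⟨x, hx, hi⟩))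
  omega

/-- In large degrees, `act` is injective. -/
lemma exists_act_injective [Module.FinitePresentation (FreeAlg k n) M.carrier] :
    ∃ d : ℤ, ∀ j, d ≤ j → ∀ v : Fin (n + 1) → M.carrier, (∀ a, v a ∈ M.deg j) →
      act k M.carrier v = 0 → v = 0 := by
  have hfin := finite_ker_act (k := k) (n := n) M.carrier
  have hfg : (LinearMap.ker (act (n := n) k M.carrier)).FG := Module.Finite.iff_fg.1 hfin
  -- The kernel lives in `M^{n+1}`, so the degree bound is applied to each of its coordinate
  -- projections, which are finite dimensional subspaces of `M`.
  choose d hd using fun a : Fin (n + 1) =>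
    M.exists_proj_eq_zero_of_fg _ (hfg.map (LinearMap.proj a))
  obtain ⟨D, hD⟩ := (Set.finite_range d).bddAbove
  refine ⟨D, fun j hj v hv h0 => funext fun a => ?_⟩
  rw [← M.proj_of_mem (hv a)]
  exact hd a j ((hD ⟨a, rfl⟩).trans hj) _ ⟨v, h0, rfl⟩

/-- Every element is the sum of an element of a finite dimensional space and of one in the image of
`act`. -/
lemma exists_fg_add_act [Module.Finite (FreeAlg k n) M.carrier] :
    ∃ W : Submodule k M.carrier, W.FG ∧
      ∀ m, ∃ w ∈ W, ∃ v : Fin (n + 1) → M.carrier, m = w + act k M.carrier v := by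
  have hfin := finite_coker_act (k := k) (n := n) M.carrier
  obtain ⟨l, hl⟩ :=
    (LinearMap.range (act (n := n) k M.carrier)).mkQ.exists_rightInverse_of_surjective
      (Submodule.range_mkQ _)
  have hl' : ∀ x, (LinearMap.range (act (n := n) k M.carrier)).mkQ (l x) = x :=
    fun x => congrArg (fun f => f x) hl
  refine ⟨LinearMap.range l, Module.Finite.iff_fg.1 inferInstance, fun m => ?_⟩
  have h := hl' ((LinearMap.range (act (n := n) k M.carrier)).mkQ m)
  obtain ⟨v, hv⟩ := (Submodule.Quotient.eq _).1 h.symm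
  exact ⟨_, ⟨_, rfl⟩, v, by rw [hv]; abel⟩

/-- In large degrees, `act` is surjective. -/
lemma exists_act_surjective [Module.Finite (FreeAlg k n) M.carrier] :
    ∃ d : ℤ, ∀ j, d ≤ j → ∀ m ∈ M.deg (j + 1), ∃ v : Fin (n + 1) → M.carrier,
      (∀ a, v a ∈ M.deg j) ∧ act k M.carrier v = m := by
  obtain ⟨W, hW, h⟩ := M.exists_fg_add_act
  obtain ⟨d, hd⟩ := M.exists_proj_eq_zero_of_fg W hW
  refine ⟨d, fun j hj m hm => ?_⟩
  obtain ⟨w, hw, v, rfl⟩ := h m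
  -- `act` raises degrees by one, so only the degree `j` parts of `v` contribute to degree `j + 1`,
  -- where `w` has no component.
  refine ⟨fun a => M.proj j (v a), fun a => M.proj_mem _ _, ?_⟩
  rw [← M.proj_of_mem hm, map_add, hd _ (by omega) w hw, zero_add, proj_act]
  simp

/-- `M_j` lies in the sum of a projection of the finite dimensional `W` and the image of
`M_{j-1}^{n+1}`; the induction starts below the lowest degree of `M`. -/
instance finite_deg [Module.Finite (FreeAlg k n) M.carrier] (j : ℤ) :
    Module.Finite k (M.deg j) := by
  obtain ⟨W, hW, h⟩ := M.exists_fg_add_act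
  obtain ⟨d, hd⟩ := M.exists_bound
  have key : ∀ (q : ℕ) (j : ℤ), j < d + q → (M.deg j).FG := by
    intro q
    induction q with
    | zero => intro j hj; rw [hd j (by simpa using hj)]; exact Submodule.fg_bot
    | succ q ih =>
      intro j hj
      have h1 := ih (j - 1) (by push_cast at hj; omega)
      have h2 : (Submodule.pi Set.univ fun _ : Fin (n + 1) => M.deg (j - 1)).FG :=
        Submodule.fg_pi fun _ => h1
      refine Submodule.FG.of_le ((hW.map (M.proj j)).sup (h2.map (act k M.carrier))) ?_
      intro m hm
      obtain ⟨w, hw, v, hv⟩ := h m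
      rw [← M.proj_of_mem hm, hv, map_add, proj_act]
      exact Submodule.add_mem_sup ⟨w, hw, rfl⟩ ⟨_, fun a _ => M.proj_mem _ _, rfl⟩
  exact Module.Finite.iff_fg.2 (key (j - d + 1).toNat j (by omega))

/-- A finitely generated graded module that vanishes in large degrees is finite dimensional. -/
lemma finiteDimensional_of_deg_eq_bot [Module.Finite (FreeAlg k n) M.carrier] {d : ℤ}
    (h : ∀ j, d ≤ j → M.deg j = ⊥) : FiniteDimensional k M.carrier := by
  obtain ⟨b, hb⟩ := M.exists_bound
  have hfg : (⨆ j ∈ Finset.Ico b d, M.deg j).FG :=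
    Submodule.fg_biSup _ _ fun j _ => Module.Finite.iff_fg.1 inferInstance
  have htop : (⨆ j ∈ Finset.Ico b d, M.deg j) = ⊤ := by
    refine eq_top_iff.2 fun m _ => M.homog_induction _ (fun j => ?_) m
    by_cases hj : j ∈ Finset.Ico b d
    · exact le_iSup₂_of_le j hj le_rfl
    · rw [Finset.mem_Ico, not_and_or, not_le, not_lt] at hj
      rcases hj with hj | hj
      · rw [hb j hj]; exact bot_le
      · rw [h j hj]; exact bot_le
  exact ⟨htop ▸ hfg⟩

/-- A finite dimensional graded module vanishes in large degrees. -/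
lemma exists_deg_eq_bot [FiniteDimensional k M.carrier] :
    ∃ d : ℤ, ∀ j, d ≤ j → M.deg j = ⊥ := by
  obtain ⟨d, hd⟩ := M.exists_proj_eq_zero_of_fg ⊤ Module.Finite.fg_top
  refine ⟨d, fun j hj => (Submodule.eq_bot_iff _).2 fun m hm => ?_⟩
  rw [← M.proj_of_mem hm, hd j hj m trivial]

/-! ### Morphisms that are bijective in large degrees. -/

variable {M} {N : GrMod k n} (f : M ⟶ N)

/-- The component of degree `j` of a morphism. -/
def degMap (j : ℤ) : M.deg j →ₗ[k] N.deg j :=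
  ((Hom.lin f).restrictScalars k).restrict (Hom.map_deg f j)

lemma degMap_injective_iff (j : ℤ) :
    Function.Injective (degMap f j) ↔ (kerObj f).deg j = ⊥ := by
  rw [injective_iff_map_eq_zero, Submodule.eq_bot_iff]
  constructor
  · intro h m hm
    have : (⟨m.1, hm⟩ : M.deg j).1 = 0 := congrArg Subtype.val (h ⟨m.1, hm⟩ (Subtype.ext m.2))
    exact Subtype.ext this
  · intro h m hm
    let x : LinearMap.ker (Hom.lin f) := ⟨m.1, congrArg Subtype.val hm⟩
    have : x.1 = 0 := congrArg Subtype.val (show x = 0 from h x m.2)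
    exact Subtype.ext this

lemma degMap_surjective_iff (j : ℤ) :
    Function.Surjective (degMap f j) ↔ (cokerObj f).deg j = ⊥ := by
  rw [Submodule.eq_bot_iff]
  constructor
  · rintro h _ ⟨m, hm, rfl⟩
    obtain ⟨x, hx⟩ := h ⟨m, hm⟩
    exact (Submodule.Quotient.mk_eq_zero _).2 ⟨x.1, congrArg Subtype.val hx⟩
  · rintro h ⟨m, hm⟩
    obtain ⟨x, hx⟩ := (Submodule.Quotient.mk_eq_zero _).1 (h _ ⟨m, hm, rfl⟩)
    -- The preimage `x` need not be homogeneous, but its component of degree `j` is again a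
    -- preimage.
    refine ⟨⟨M.proj j x, M.proj_mem _ _⟩, Subtype.ext ?_⟩
    change Hom.lin f (M.proj j x) = m
    rw [lin_proj, hx, N.proj_of_mem hm]

/-- Kernel and cokernel are finite dimensional if and only if the morphism is bijective in large
degrees. -/
lemma finiteDimensional_ker_coker_iff [Module.FinitePresentation (FreeAlg k n) M.carrier]
    [Module.FinitePresentation (FreeAlg k n) N.carrier] :
    (FiniteDimensional k (kerObj f).carrier ∧ FiniteDimensional k (cokerObj f).carrier) ↔
      ∃ d : ℤ, ∀ j, d ≤ j → Function.Bijective (degMap f j) := by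
  constructor
  · rintro ⟨_, _⟩
    obtain ⟨d, hd⟩ := (kerObj f).exists_deg_eq_bot
    obtain ⟨d', hd'⟩ := (cokerObj f).exists_deg_eq_bot
    exact ⟨max d d', fun j hj => ⟨(degMap_injective_iff f j).2 (hd j (by omega)),
      (degMap_surjective_iff f j).2 (hd' j (by omega))⟩⟩
  · rintro ⟨d, hd⟩
    have := finitePresentation_ker f
    have : Module.Finite (FreeAlg k n) (cokerObj f).carrier :=
      inferInstanceAs (Module.Finite (FreeAlg k n) (N.carrier ⧸ LinearMap.range (Hom.lin f)))
    exact ⟨finiteDimensional_of_deg_eq_bot _ fun j hj => (degMap_injective_iff f j).1 (hd j hj).1,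
      finiteDimensional_of_deg_eq_bot _ fun j hj => (degMap_surjective_iff f j).1 (hd j hj).2⟩

/-! ### Dimensions of graded components and approximation by free modules. -/

variable (M)

/-- `dim M_{j+1} = (n + 1) dim M_j` for large `j`. -/
lemma exists_finrank_deg_succ [Module.FinitePresentation (FreeAlg k n) M.carrier] :
    ∃ d : ℤ, ∀ j, d ≤ j →
      Module.finrank k (M.deg (j + 1)) = (n + 1) * Module.finrank k (M.deg j) := by
  obtain ⟨d, hd⟩ := M.exists_act_injective
  obtain ⟨d', hd'⟩ := M.exists_act_surjective
  refine ⟨max d d', fun j hj => ?_⟩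
  let φ : (Fin (n + 1) → M.deg j) →ₗ[k] M.deg (j + 1) :=
    LinearMap.codRestrict _ (act k M.carrier ∘ₗ (M.deg j).subtype.compLeft (Fin (n + 1)))
      fun v => by
        change act k M.carrier (fun a => (v a).1) ∈ _
        rw [act_apply]
        refine Submodule.sum_mem _ fun a _ => ?_
        rw [add_comm j 1]
        exact M.smul_mem (ι_mem a) (v a).2
  have hφ : Function.Bijective φ := by
    constructor
    · rw [injective_iff_map_eq_zero]
      intro v hv
      have := hd j (by omega) (fun a => (v a).1) (fun a => (v a).2) (congrArg Subtype.val hv)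
      funext a
      exact Subtype.ext (congrFun this a)
    · rintro ⟨m, hm⟩
      obtain ⟨v, hv, rfl⟩ := hd' j (by omega) m hm
      exact ⟨fun a => ⟨v a, hv a⟩, rfl⟩
  rw [← (LinearEquiv.ofBijective φ hφ).finrank_eq, Module.finrank_pi_fintype]
  simp

lemma exists_finrank_deg_add [Module.FinitePresentation (FreeAlg k n) M.carrier] :
    ∃ d : ℤ, ∀ j, d ≤ j → ∀ q : ℕ,
      Module.finrank k (M.deg (j + q)) = (n + 1) ^ q * Module.finrank k (M.deg j) := by
  obtain ⟨d, hd⟩ := M.exists_finrank_deg_succ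
  refine ⟨d, fun j hj q => ?_⟩
  induction q with
  | zero => rw [Nat.cast_zero, add_zero, pow_zero, one_mul]
  | succ q ih =>
    rw [Nat.cast_succ, ← add_assoc, hd _ (by omega), ih, pow_succ]
    ring

variable (k n) in
lemma finrank_homog (q : ℕ) : Module.finrank k (homog k n q) = (n + 1) ^ q := by
  have hli : LinearIndependent k (fun w : List.Vector (Fin (n + 1)) q => monom k w.1) := by
    have := (monomBasis k n).linearIndependent.comp
      (fun w : List.Vector (Fin (n + 1)) q => FreeMonoid.ofList w.1)
      (fun v w h => Subtype.ext (FreeMonoid.ofList.injective h))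
    convert this using 2 with w
    exact (monomBasis_apply k n w.1).symm
  have hspan : homog k n q =
      Submodule.span k (Set.range fun w : List.Vector (Fin (n + 1)) q => monom k w.1) := by
    rw [homog]
    congr 1
    ext x
    constructor
    · rintro ⟨w, hw, rfl⟩; exact ⟨⟨w, by exact_mod_cast hw⟩, rfl⟩
    · rintro ⟨w, rfl⟩; exact ⟨w.1, by exact_mod_cast w.2, rfl⟩
  rw [hspan, finrank_span_eq_card hli, card_vector, Fintype.card_fin]

variable (k n) in
/-- The graded free module `R(-d)^r`. -/
abbrev free (d : ℤ) (r : ℕ) : GrMod k n := pi (fun _ : Fin r => (self k n).twist (-d))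

instance (d : ℤ) (r : ℕ) : Module.FinitePresentation (FreeAlg k n) (free k n d r).carrier :=
  inferInstanceAs (Module.FinitePresentation (FreeAlg k n) (Fin r → FreeAlg k n))

lemma finrank_free_deg (d : ℤ) (r q : ℕ) :
    Module.finrank k ((free k n d r).deg (d + q)) = (n + 1) ^ q * r := by
  let e : (free k n d r).deg (d + q) ≃ₗ[k] (Fin r → homog k n q) :=
    { toFun v i := ⟨v.1 i, by
        have := v.2 i trivial
        change v.1 i ∈ homog k n (-d + (d + q)) at this
        rwa [neg_add_cancel_left] at this⟩
      invFun v := ⟨fun i => (v i).1, fun i _ => by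
        change (v i).1 ∈ homog k n (-d + (d + q))
        rw [neg_add_cancel_left]
        exact (v i).2⟩
      map_add' _ _ := rfl
      map_smul' _ _ := rfl
      left_inv _ := rfl
      right_inv _ := rfl }
  -- `finrank` takes the default value `0` on infinite dimensional spaces, so a positive value
  -- proves finiteness.
  have : Module.Finite k (homog k n q) := Module.finite_of_finrank_pos (by
    rw [finrank_homog]; positivity)
  rw [e.finrank_eq, Module.finrank_pi_fintype]
  simp [finrank_homog, mul_comm]

/-- For large `d`, a basis of `M_d` gives a morphism `R(-d)^r ⟶ M` that is bijective in degrees at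
least `d`. -/
lemma exists_freeHom_bijective [Module.FinitePresentation (FreeAlg k n) M.carrier] :
    ∃ d₀ : ℤ, ∀ d, d₀ ≤ d → ∃ (g : Fin (Module.finrank k (M.deg d)) → M.carrier)
      (hg : ∀ i, g i ∈ M.deg d), ∀ j, d ≤ j →
        Function.Bijective (degMap (M.freeHom (fun _ => d) g hg) j) := by
  obtain ⟨d₁, h₁⟩ := M.exists_finrank_deg_add
  obtain ⟨d₂, h₂⟩ := M.exists_act_surjective
  refine ⟨max d₁ d₂, fun d hd => ?_⟩
  let b := Module.finBasis k (M.deg d)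
  refine ⟨fun i => (b i).1, fun i => (b i).2, fun j hj => ?_⟩
  set φ := M.freeHom (fun _ => d) (fun i => (b i).1) (fun i => (b i).2)
  have hrange : LinearMap.range (Hom.lin φ) =
      Submodule.span (FreeAlg k n) (Set.range fun i => (b i).1) :=
    Fintype.range_linearCombination _ _
  -- The image contains a basis of `M_d`, and each later component is `∑ xₐ` times the preceding
  -- one.
  have hle : ∀ q : ℕ, M.deg (d + q) ≤ (LinearMap.range (Hom.lin φ)).restrictScalars k := by
    intro q
    induction q with
    | zero =>
      intro m hm
      rw [Nat.cast_zero, add_zero] at hm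
      have := congrArg Subtype.val (b.sum_repr ⟨m, hm⟩)
      rw [← show _ = m from this, Submodule.coe_sum]
      refine Submodule.sum_mem _ fun i _ => Submodule.smul_mem _ _ ?_
      change (b i).1 ∈ LinearMap.range (Hom.lin φ)
      rw [hrange]
      exact Submodule.subset_span ⟨i, rfl⟩
    | succ q ih =>
      intro m hm
      rw [Nat.cast_succ, ← add_assoc] at hm
      obtain ⟨v, hv, rfl⟩ := h₂ _ (by omega) m hm
      rw [act_apply]
      exact Submodule.sum_mem _ fun a _ =>
        (LinearMap.range (Hom.lin φ)).smul_mem _ (ih (hv a))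
  obtain ⟨q, rfl⟩ : ∃ q : ℕ, j = d + q := ⟨(j - d).toNat, by omega⟩
  have hsurj : Function.Surjective (degMap φ (d + q)) := by
    rintro ⟨m, hm⟩
    obtain ⟨x, hx⟩ := hle q hm
    refine ⟨⟨_, proj_mem _ (d + q) x⟩, Subtype.ext ?_⟩
    change Hom.lin φ (proj _ (d + q) x) = m
    rw [lin_proj, hx, M.proj_of_mem hm]
  -- Injectivity is a dimension count: both sides have dimension `(n+1)^q dim M_d`.
  refine ⟨(LinearMap.injective_iff_surjective_of_finrank_eq_finrank ?_).2 hsurj, hsurj⟩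
  rw [h₁ d (by omega)]
  exact finrank_free_deg d _ q

/-- Morphisms from free modules lift along surjections. -/
lemma exists_freeHom_lift {M N : GrMod k n} (p : M ⟶ N) (hp : Function.Surjective (Hom.lin p))
    {s : ℕ} (e : Fin s → ℤ) (g : Fin s → N.carrier) (hg : ∀ i, g i ∈ N.deg (e i)) :
    ∃ ψ : pi (fun i => (self k n).twist (-e i)) ⟶ M, ψ ≫ p = N.freeHom e g hg := by
  choose h hh using fun i => hp (g i)
  -- The chosen preimages are replaced by their components of the right degree, so that the lift
  -- preserves degrees.
  refine ⟨M.freeHom e (fun i => M.proj (e i) (h i)) fun i => M.proj_mem _ _, ?_⟩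
  apply hom_ext
  apply LinearMap.ext
  intro v
  change Hom.lin p (∑ i, (show FreeAlg k n from v i) • M.proj (e i) (h i)) =
    ∑ i, (show FreeAlg k n from v i) • g i
  rw [map_sum]
  refine Finset.sum_congr rfl fun i _ => ?_
  rw [map_smul, lin_proj, hh, N.proj_of_mem (hg i)]

end GrMod

end LargeDegree

/-! ### Objects and short exact sequences of `coh 𝕏ⁿ` -/

section CohStructure

variable {k : Type u} [Field k] {n : ℕ}

open ObjectProperty

instance (M : FpGr k n) : Module.FinitePresentation (FreeAlg k n) M.obj.carrier := M.property

/-- Morphisms with finite dimensional kernel and cokernel are those that are bijective in large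
degrees. -/
lemma isoModSerre_fdim_iff {M N : FpGr k n} (f : M ⟶ N) :
    (fdim k n).isoModSerre f ↔
      ∃ d : ℤ, ∀ j, d ≤ j → Function.Bijective (GrMod.degMap f.hom j) := by
  rw [isoModSerre_iff, monoModSerre_iff, epiModSerre_iff,
    ← GrMod.finiteDimensional_ker_coker_iff]
  -- The inclusion of `gr R` into all graded modules preserves kernels and cokernels, so the
  -- abstract ones may be replaced by the explicit ones.
  let e₁ : (kernel f).obj ≅ GrMod.kerObj f.hom :=
    PreservesKernel.iso (isFinPres k n).ι f ≪≫
      IsLimit.conePointUniqueUpToIso (kernelIsKernel _) (GrMod.kerIsLimit f.hom)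
  let e₂ : (cokernel f).obj ≅ GrMod.cokerObj f.hom :=
    PreservesCokernel.iso (isFinPres k n).ι f ≪≫
      IsColimit.coconePointUniqueUpToIso (cokernelIsCokernel _) (GrMod.cokerIsColimit f.hom)
  exact and_congr ((isFinDim k n).prop_iff_of_iso e₁) ((isFinDim k n).prop_iff_of_iso e₂)

/-! ### The growth rate of a finitely presented module. -/

lemma exists_growth (M : FpGr k n) : ∃ q : ℚ, ∃ d₀ : ℤ, ∀ d, d₀ ≤ d →
    (Module.finrank k (M.obj.deg d) : ℚ) = q * ((n : ℚ) + 1) ^ d := by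
  obtain ⟨d₀, h⟩ := M.obj.exists_finrank_deg_add
  have hn : (n : ℚ) + 1 ≠ 0 := by positivity
  refine ⟨Module.finrank k (M.obj.deg d₀) * ((n : ℚ) + 1) ^ (-d₀), d₀, fun d hd => ?_⟩
  obtain ⟨q, rfl⟩ : ∃ q : ℕ, d = d₀ + q := ⟨(d - d₀).toNat, by omega⟩
  rw [h d₀ le_rfl, mul_assoc, ← zpow_add₀ hn, neg_add_cancel_left, zpow_natCast]
  push_cast
  ring

/-- The limit of `dim M_d / (n + 1) ^ d` for `d → ∞`. -/
def growth (M : FpGr k n) : ℚ := (exists_growth M).choose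

lemma growth_spec (M : FpGr k n) : ∃ d₀ : ℤ, ∀ d, d₀ ≤ d →
    (Module.finrank k (M.obj.deg d) : ℚ) = growth M * ((n : ℚ) + 1) ^ d :=
  (exists_growth M).choose_spec

/-- The formula holds exactly in large degrees, not just asymptotically, so comparing two candidates
in a single common degree suffices. -/
lemma growth_eq {M : FpGr k n} {q : ℚ} {d₀ : ℤ} (h : ∀ d, d₀ ≤ d →
    (Module.finrank k (M.obj.deg d) : ℚ) = q * ((n : ℚ) + 1) ^ d) : growth M = q := by
  obtain ⟨d₁, h₁⟩ := growth_spec M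
  have := (h₁ (max d₀ d₁) (le_max_right _ _)).symm.trans (h _ (le_max_left _ _))
  exact mul_right_cancel₀ (by positivity) this

lemma growth_eq_of_isoModSerre {M N : FpGr k n} {f : M ⟶ N} (hf : (fdim k n).isoModSerre f) :
    growth M = growth N := by
  obtain ⟨d, hd⟩ := (isoModSerre_fdim_iff f).1 hf
  obtain ⟨d₁, h₁⟩ := growth_spec N
  refine growth_eq (d₀ := max d d₁) fun j hj => ?_
  rw [← h₁ j (by omega), (LinearEquiv.ofBijective _ (hd j (by omega))).finrank_eq]

/-- An isomorphism of the quotient need not come from `gr R`, but it is a fraction `M ← X → N`. The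
left leg is inverted by definition, the right leg because its image is then invertible; both are
therefore bijective in large degrees. -/
lemma growth_eq_of_iso {M N : FpGr k n} (e : (quot k n).obj M ≅ (quot k n).obj N) :
    growth M = growth N := by
  obtain ⟨φ, hφ⟩ := Localization.exists_rightFraction (quot k n) (fdim k n).isoModSerre e.hom
  have h := φ.map_s_comp_map (quot k n) (Localization.inverts _ _)
  rw [← hφ] at h
  have := Localization.inverts (quot k n) (fdim k n).isoModSerre φ.s φ.hs
  have hf : IsIso ((quot k n).map φ.f) := by rw [← h]; infer_instance
  rw [← growth_eq_of_isoModSerre φ.hs]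
  exact growth_eq_of_isoModSerre
    ((SerreClassLocalization.isIso_map_iff (quot k n) (fdim k n) φ.f).1 hf)

lemma growth_biprod (M N : FpGr k n) : growth (M ⊞ N) = growth M + growth N := by
  obtain ⟨d, hd⟩ := growth_spec M
  obtain ⟨d', hd'⟩ := growth_spec N
  refine growth_eq (d₀ := max d d') fun j hj => ?_
  have key {X Y Z : FpGr k n} (f : X ⟶ Y) (g : Y ⟶ Z) (x : X.obj.deg j) :
      GrMod.degMap g.hom j (GrMod.degMap f.hom j x) = GrMod.degMap (f ≫ g).hom j x := rfl
  let e : (M ⊞ N).obj.deg j ≃ₗ[k] M.obj.deg j × N.obj.deg j :=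
    LinearEquiv.ofLinearMap
      (LinearMap.prod (GrMod.degMap (biprod.fst : M ⊞ N ⟶ M).hom j)
        (GrMod.degMap (biprod.snd : M ⊞ N ⟶ N).hom j))
      (LinearMap.coprod (GrMod.degMap (biprod.inl : M ⟶ M ⊞ N).hom j)
        (GrMod.degMap (biprod.inr : N ⟶ M ⊞ N).hom j))
      (by
        apply LinearMap.ext
        rintro ⟨x, y⟩
        simp only [LinearMap.comp_apply, LinearMap.coprod_apply, LinearMap.prod_apply,
          Function.prod_apply, map_add, key, biprod.inl_fst, biprod.inr_fst, biprod.inl_snd,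
          biprod.inr_snd]
        exact Prod.ext (add_zero x) (zero_add y))
      (by
        apply LinearMap.ext
        intro x
        simp only [LinearMap.comp_apply, LinearMap.coprod_apply, LinearMap.prod_apply,
          Function.prod_apply, key]
        have : GrMod.degMap (biprod.fst ≫ biprod.inl + biprod.snd ≫ biprod.inr :
          M ⊞ N ⟶ M ⊞ N).hom j x = x := by rw [biprod.total]; rfl
        exact this)
  rw [e.finrank_eq, Module.finrank_prod]
  push_cast
  rw [hd j (by omega), hd' j (by omega), add_mul]

lemma growth_selfTwist (i : ℤ) : growth (selfTwist k n i) = ((n : ℚ) + 1) ^ i := by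
  -- `R(i)_d = R_{i+d}` has dimension `(n+1)^{i+d}` as soon as `i + d ≥ 0`.
  refine growth_eq (d₀ := -i) fun d hd => ?_
  obtain ⟨q, hq⟩ : ∃ q : ℕ, i + d = q := ⟨(i + d).toNat, by omega⟩
  rw [← zpow_add₀ (by positivity)]
  change (Module.finrank k (homog k n (i + d)) : ℚ) = _
  rw [hq, GrMod.finrank_homog, zpow_natCast]
  push_cast
  rfl

/-! ### Graded free modules, their direct sum decompositions and their lifting property. -/

variable (k n) in
/-- The graded free module `R(-d)^r` as an object of `gr R`. -/
def freeFp (d : ℤ) (r : ℕ) : FpGr k n :=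
  ⟨GrMod.free k n d r,
    inferInstanceAs (Module.FinitePresentation (FreeAlg k n) (GrMod.free k n d r).carrier)⟩

lemma growth_freeFp (d : ℤ) (r : ℕ) : growth (freeFp k n d r) = r * ((n : ℚ) + 1) ^ (-d) := by
  refine growth_eq (d₀ := d) fun j hj => ?_
  obtain ⟨q, rfl⟩ : ∃ q : ℕ, j = d + q := ⟨(j - d).toNat, by omega⟩
  rw [mul_assoc, ← zpow_add₀ (by positivity), neg_add_cancel_left, zpow_natCast, mul_comm]
  exact_mod_cast GrMod.finrank_free_deg (k := k) (n := n) d r q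

lemma single_mem_homog {r : ℕ} {j : ℤ} {x : FreeAlg k n} (hx : x ∈ homog k n j) (i l : Fin r) :
    (Pi.single i x : Fin r → FreeAlg k n) l ∈ homog k n j := by
  by_cases h : l = i
  · subst h
    rwa [Pi.single_eq_same]
  · rw [Pi.single_eq_of_ne h]
    exact zero_mem _

variable (k n) in
/-- `R(-d)^r` as a bicone over `r` copies of `R(-d)`. -/
def freeBicone (d : ℤ) (r : ℕ) : Bicone (fun _ : Fin r => selfTwist k n (-d)) where
  pt := freeFp k n d r
  π i := homMk (GrMod.piProj (fun _ : Fin r => (GrMod.self k n).twist (-d)) i)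
  ι i := homMk
    { lin := LinearMap.single (FreeAlg k n) (fun _ : Fin r => FreeAlg k n) i
      map_deg _ _ hm l _ := single_mem_homog hm i l }
  ι_π i j := by
    by_cases h : i = j
    · subst h
      rw [dif_pos rfl]
      apply ObjectProperty.hom_ext
      apply GrMod.hom_ext
      exact LinearMap.ext fun x => Pi.single_eq_same (M := fun _ : Fin r => FreeAlg k n) i x
    · rw [dif_neg h]
      apply ObjectProperty.hom_ext
      apply GrMod.hom_ext
      exact LinearMap.ext fun x =>
        Pi.single_eq_of_ne (M := fun _ : Fin r => FreeAlg k n) (Ne.symm h) x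

lemma sum_hom_lin {ι : Type*} (s : Finset ι) {M N : FpGr k n} (f : ι → (M ⟶ N)) :
    GrMod.Hom.lin (∑ i ∈ s, f i).hom = ∑ i ∈ s, GrMod.Hom.lin (f i).hom := by
  classical
  induction s using Finset.induction_on with
  | empty => rfl
  | insert a s ha ih => rw [Finset.sum_insert ha, Finset.sum_insert ha, ← ih]; rfl

variable (k n) in
/-- `R(-d)^r` is a direct sum of `r` copies of `R(-d)`. -/
def freeIsBilimit (d : ℤ) (r : ℕ) : (freeBicone k n d r).IsBilimit := by
  refine isBilimitOfTotal _ ?_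
  apply ObjectProperty.hom_ext
  apply GrMod.hom_ext
  rw [sum_hom_lin]
  apply LinearMap.ext
  intro v
  rw [LinearMap.sum_apply]
  exact Finset.univ_sum_single (M := fun _ : Fin r => FreeAlg k n) v

variable (k n) in
/-- The image of `R(-d)^r` in `coh 𝕏ⁿ` is `𝒪(-d)^r`. -/
def quotFreeIso (d : ℤ) (r : ℕ) :
    (quot k n).obj (freeFp k n d r) ≅ ⨁ fun _ : Fin r => structureSheaf k n (-d) :=
  biproduct.uniqueUpToIso (fun _ : Fin r => structureSheaf k n (-d))
    (isBilimitOfPreserves (quot k n) (freeIsBilimit k n d r))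

/-- Every finitely presented graded module admits morphisms in `isoModSerre` from free modules,
which lift along epimorphisms. -/
lemma exists_isoModSerre_free (M : FpGr k n) : ∃ i₀ : ℤ, ∀ i, i₀ ≤ i → ∃ r : ℕ,
    ∃ φ : freeFp k n i r ⟶ M, (fdim k n).isoModSerre φ ∧
      ∀ (L : FpGr k n) (p : L ⟶ M) [Epi p], ∃ ψ : freeFp k n i r ⟶ L, ψ ≫ p = φ := by
  obtain ⟨i₀, h⟩ := M.obj.exists_freeHom_bijective
  refine ⟨i₀, fun i hi => ?_⟩
  obtain ⟨g, hg, hbij⟩ := h i hi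
  refine ⟨_, homMk (M.obj.freeHom (fun _ => i) g hg), (isoModSerre_fdim_iff _).2 ⟨i, hbij⟩, ?_⟩
  intro L p _
  -- The inclusion preserves epimorphisms, so `p` is surjective on underlying modules.
  have hp : Epi p.hom := inferInstanceAs (Epi ((isFinPres k n).ι.map p))
  obtain ⟨ψ, hψ⟩ := GrMod.exists_freeHom_lift p.hom (GrMod.surjective_of_epi p.hom)
    (fun _ => i) g hg
  exact ⟨homMk ψ, ObjectProperty.hom_ext _ hψ⟩

instance : (quot k n).EssSurj := Localization.essSurj (quot k n) (fdim k n).isoModSerre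

/-- A module representing `F` agrees in large degrees with a free one, and the quotient functor does
not see the finite dimensional discrepancy. -/
lemma exists_iso_biproduct (F : Coh k n) : ∃ i₀ : ℤ, ∀ i : ℤ, i₀ ≤ i → ∃ r : ℕ,
    Nonempty (F ≅ ⨁ fun _ : Fin r => structureSheaf k n (-i)) := by
  obtain ⟨i₀, h⟩ := exists_isoModSerre_free ((quot k n).objPreimage F)
  refine ⟨i₀, fun i hi => ?_⟩
  obtain ⟨r, φ, hφ, -⟩ := h i hi
  have := Localization.inverts (quot k n) (fdim k n).isoModSerre φ hφ
  exact ⟨r, ⟨((quot k n).objObjPreimageIso F).symm ≪≫ (asIso ((quot k n).map φ)).symm ≪≫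
    quotFreeIso k n i r⟩⟩

/-- Up to isomorphism of arrows, `f` is the image of an epimorphism `p : X ⟶ Y` of `gr R`. The map
`φ` from a free module to `Y` lifts through `p` and becomes invertible in the quotient; the inverse
of `φ` followed by the lift is a section. -/
lemma exists_section_of_epi {F G : Coh k n} (f : F ⟶ G) [Epi f] : ∃ s : G ⟶ F, s ≫ f = 𝟙 G := by
  obtain ⟨X, Y, p, hp, ⟨e⟩⟩ := (SerreClassLocalization.epi_iff (quot k n) (fdim k n) f).1 ‹_›
  obtain ⟨i₀, h⟩ := exists_isoModSerre_free Y
  obtain ⟨r, φ, hφ, hlift⟩ := h i₀ le_rfl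
  obtain ⟨ψ, hψ⟩ := hlift X p
  have := Localization.inverts (quot k n) (fdim k n).isoModSerre φ hφ
  have w : e.hom.left ≫ f = (quot k n).map p ≫ e.hom.right := e.hom.w
  have w' : e.inv.right ≫ e.hom.right = 𝟙 G := by
    rw [← Arrow.comp_right, e.inv_hom_id]; rfl
  refine ⟨e.inv.right ≫ inv ((quot k n).map φ) ≫ (quot k n).map ψ ≫ e.hom.left, ?_⟩
  simp only [Category.assoc]
  rw [w, ← Functor.map_comp_assoc, hψ, IsIso.inv_hom_id_assoc, w']

lemma nonempty_splitting (S : ShortComplex (Coh k n)) (hS : S.ShortExact) :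
    Nonempty S.Splitting := by
  have := hS.epi_g
  obtain ⟨s, hs⟩ := exists_section_of_epi S.g
  exact ⟨ShortComplex.Splitting.ofExactOfSection S hS.exact s hs hS.mono_f⟩

/-! ### Rank as a complete invariant of objects. -/

/-- The rank of an object of `coh 𝕏ⁿ`, normalized such that `𝒪` has rank `1`. -/
def rank (F : Coh k n) : ℚ := growth ((quot k n).objPreimage F)

lemma rank_congr {F G : Coh k n} (e : F ≅ G) : rank F = rank G :=
  growth_eq_of_iso ((quot k n).objObjPreimageIso F ≪≫ e ≪≫ ((quot k n).objObjPreimageIso G).symm)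

lemma rank_quot_obj (M : FpGr k n) : rank ((quot k n).obj M) = growth M :=
  growth_eq_of_iso ((quot k n).objObjPreimageIso _)

lemma rank_structureSheaf (i : ℤ) : rank (structureSheaf k n i) = ((n : ℚ) + 1) ^ i :=
  (rank_quot_obj _).trans (growth_selfTwist i)

lemma rank_biproduct_structureSheaf (i : ℤ) (r : ℕ) :
    rank (⨁ fun _ : Fin r => structureSheaf k n (-i)) = r * ((n : ℚ) + 1) ^ (-i) := by
  rw [← rank_congr (quotFreeIso k n i r), rank_quot_obj, growth_freeFp]

lemma rank_biprod (F G : Coh k n) : rank (F ⊞ G) = rank F + rank G := by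
  change _ = growth _ + growth _
  rw [← growth_biprod, ← rank_quot_obj]
  have : PreservesBinaryBiproducts (quot k n) := preservesBinaryBiproducts_of_preservesBiproducts _
  exact rank_congr (biprod.mapIso ((quot k n).objObjPreimageIso F).symm
    ((quot k n).objObjPreimageIso G).symm ≪≫ ((quot k n).mapBiprod _ _).symm)

/-- Objects of the same rank are isomorphic. -/
lemma nonempty_iso_of_rank_eq {F G : Coh k n} (h : rank F = rank G) : Nonempty (F ≅ G) := by
  obtain ⟨i, hi⟩ := exists_iso_biproduct F
  obtain ⟨j, hj⟩ := exists_iso_biproduct G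
  -- With a common twist for both objects, equal ranks mean equal numbers of copies.
  obtain ⟨r, ⟨e⟩⟩ := hi (max i j) (le_max_left _ _)
  obtain ⟨s, ⟨e'⟩⟩ := hj (max i j) (le_max_right _ _)
  rw [rank_congr e, rank_congr e', rank_biproduct_structureSheaf,
    rank_biproduct_structureSheaf] at h
  obtain rfl : r = s := by exact_mod_cast mul_right_cancel₀ (by positivity) h
  exact ⟨e ≪≫ e'.symm⟩

/-- The empty direct sum is a zero object of rank `0`, and rank determines the isomorphism class. -/
lemma rank_eq_zero_iff (F : Coh k n) : rank F = 0 ↔ IsZero F := by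
  have hz : IsZero (⨁ fun _ : Fin 0 => structureSheaf k n (-0)) := by
    rw [IsZero.iff_id_eq_zero]
    exact biproduct.hom_ext _ _ fun i => i.elim0
  have hr : rank (⨁ fun _ : Fin 0 => structureSheaf k n (-0)) = 0 := by
    rw [rank_biproduct_structureSheaf]; simp
  constructor
  · intro h
    obtain ⟨e⟩ := nonempty_iso_of_rank_eq (h.trans hr.symm)
    exact hz.of_iso e
  · intro h
    rw [rank_congr (h.iso hz), hr]

lemma not_isZero_structureSheaf (i : ℤ) : ¬ IsZero (structureSheaf k n i) := by
  rw [← rank_eq_zero_iff, rank_structureSheaf]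
  positivity

/-- A nonzero object is a direct sum of arbitrarily many copies of `𝒪(-i)` for large `i`. -/
lemma exists_iso_biproduct_of_not_isZero (hn : 1 ≤ n) {F : Coh k n} (hF : ¬ IsZero F) (N : ℕ) :
    ∃ i₀ : ℤ, ∀ i : ℤ, i₀ ≤ i → ∃ r : ℕ, N < r ∧
      Nonempty (F ≅ ⨁ fun _ : Fin r => structureSheaf k n (-i)) := by
  obtain ⟨j, hj⟩ := exists_iso_biproduct F
  obtain ⟨r, ⟨e⟩⟩ := hj j le_rfl
  -- Passing from twist `-j` to `-(j + q)` multiplies the number of copies by `(n+1)^q > q`, and `q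
  -- ≥ N` here.
  refine ⟨j + N, fun i hi => ?_⟩
  obtain ⟨s, ⟨e'⟩⟩ := hj i (by omega)
  refine ⟨s, ?_, ⟨e'⟩⟩
  have hrank := (rank_congr e').symm.trans (rank_congr e)
  rw [rank_biproduct_structureSheaf, rank_biproduct_structureSheaf] at hrank
  obtain ⟨q, hq⟩ : ∃ q : ℕ, i = j + q := ⟨(i - j).toNat, by omega⟩
  have hr : r ≠ 0 := by
    rintro rfl
    refine hF ((rank_eq_zero_iff F).1 ?_)
    rw [rank_congr e, rank_biproduct_structureSheaf]; simp
  have hs : s = r * (n + 1) ^ q := by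
    have h0 : ((n : ℚ) + 1) ≠ 0 := by positivity
    have : (s : ℚ) = r * ((n : ℚ) + 1) ^ q := by
      have h1 : ((n : ℚ) + 1) ^ (-j) = ((n : ℚ) + 1) ^ q * ((n : ℚ) + 1) ^ (-i) := by
        rw [← zpow_natCast, ← zpow_add₀ h0]; congr 1; omega
      rw [h1, ← mul_assoc] at hrank
      exact mul_right_cancel₀ (by positivity) hrank
    exact_mod_cast this
  have h1 : q < (n + 1) ^ q := Nat.lt_pow_self (by omega)
  have h2 : (n + 1) ^ q ≤ r * (n + 1) ^ q := Nat.le_mul_of_pos_left _ (by omega)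
  omega

end CohStructure

/-! ### Properties of `coh 𝕏ⁿ` -/

section CohProperties

variable {k : Type u} [Field k] {n : ℕ}

/-- Every nonzero object is a direct sum of two nonzero objects. -/
lemma exists_iso_biprod (hn : 1 ≤ n) {F : Coh k n} (hF : ¬ IsZero F) :
    ∃ A B : Coh k n, ¬ IsZero A ∧ ¬ IsZero B ∧ Nonempty (F ≅ A ⊞ B) := by
  obtain ⟨i, hi⟩ := exists_iso_biproduct_of_not_isZero hn hF 1
  obtain ⟨r, hr, ⟨e⟩⟩ := hi i le_rfl
  obtain ⟨s, rfl⟩ : ∃ s, r = s + 1 := ⟨r - 1, by omega⟩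
  -- One of the at least two copies is split off; comparing ranks avoids constructing the
  -- isomorphism by hand.
  refine ⟨⨁ fun _ : Fin s => structureSheaf k n (-i), structureSheaf k n (-i), ?_,
    not_isZero_structureSheaf _, nonempty_iso_of_rank_eq ?_⟩
  · rw [← rank_eq_zero_iff, rank_biproduct_structureSheaf]
    have : (s : ℚ) ≠ 0 := by exact_mod_cast (by omega : s ≠ 0)
    positivity
  · rw [rank_congr e, rank_biprod, rank_biproduct_structureSheaf, rank_biproduct_structureSheaf,
      rank_structureSheaf]
    push_cast
    ring

lemma not_indecomposable (hn : 1 ≤ n) (F : Coh k n) : ¬ Indecomposable F := by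
  rintro ⟨hF, h⟩
  obtain ⟨A, B, hA, hB, ⟨e⟩⟩ := exists_iso_biprod hn hF
  exact (h A B e).elim hA hB

/-- Otherwise `F` has a maximal proper subobject `P`, and `F/P ≅ A ⊞ B` with both summands nonzero.
The kernel of `F ⟶ B` is proper and contains `P`, hence equals `P`; then the projection `A ⊞ B ⟶ B`
is a monomorphism, which forces `A = 0`. -/
lemma isZero_of_isNoetherianObject (hn : 1 ≤ n) (F : Coh k n) [IsNoetherianObject F] :
    IsZero F := by
  by_contra hF
  have hne : ({P : Subobject F | P ≠ ⊤} : Set (Subobject F)).Nonempty := by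
    refine ⟨⊥, fun h => hF ?_⟩
    have : IsIso (⊥ : Subobject F).arrow := (Subobject.isIso_arrow_iff_eq_top _).2 h
    rw [IsZero.iff_id_eq_zero, ← cancel_epi (⊥ : Subobject F).arrow, Subobject.bot_arrow,
      zero_comp, zero_comp]
  -- A minimal element for `>` is a maximal proper subobject.
  obtain ⟨P, hP, hmax⟩ := WellFounded.has_min
    (wellFounded_gt (α := Subobject F)) _ hne
  have hQ : ¬ IsZero (cokernel P.arrow) := by
    intro h
    have : Epi P.arrow := Preadditive.epi_of_isZero_cokernel _ h
    have : IsIso P.arrow := isIso_of_mono_of_epi _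
    exact hP ((Subobject.isIso_arrow_iff_eq_top P).1 this)
  obtain ⟨A, B, hA, hB, ⟨e⟩⟩ := exists_iso_biprod hn hQ
  let π : F ⟶ A ⊞ B := cokernel.π P.arrow ≫ e.hom
  let f : F ⟶ B := π ≫ biprod.snd
  have hPf : P ≤ kernelSubobject f := le_kernelSubobject _ _ (by simp [f, π])
  have hfne : f ≠ 0 := by
    intro h
    apply hB
    rw [IsZero.iff_id_eq_zero, ← cancel_epi f, h, zero_comp, zero_comp]
  have hK : kernelSubobject f ≠ ⊤ := by
    intro h
    apply hfne
    have : IsIso (kernelSubobject f).arrow := (Subobject.isIso_arrow_iff_eq_top _).2 h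
    rw [← cancel_epi (kernelSubobject f).arrow, kernelSubobject_arrow_comp, comp_zero]
  have hPK : P = kernelSubobject f := by
    by_contra hne'
    exact hmax _ hK (lt_of_le_of_ne hPf hne')
  have hker : kernel.ι f ≫ π = 0 := by
    have hle : kernelSubobject f ≤ P := hPK.ge
    have : (kernelSubobject f).arrow ≫ π = 0 := by
      rw [← Subobject.ofLE_arrow hle, Category.assoc, cokernel.condition_assoc, zero_comp,
        comp_zero]
    rw [← kernelSubobject_arrow' f, Category.assoc, this, comp_zero]
  -- Since `π` kills the kernel of the epimorphism `f`, it factors through `f`. Cancelling `π` then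
  -- makes `t` a retraction of `biprod.snd`.
  obtain ⟨t, ht⟩ : ∃ t : B ⟶ A ⊞ B, f ≫ t = π :=
    ⟨Abelian.epiDesc f π hker, Abelian.comp_epiDesc f π hker⟩
  have h1 : biprod.snd ≫ t = 𝟙 (A ⊞ B) := by
    rw [← cancel_epi π, Category.comp_id, ← Category.assoc]
    exact ht
  apply hA
  rw [IsZero.iff_id_eq_zero]
  have h2 := congrArg (fun g => biprod.inl ≫ g ≫ biprod.fst) h1
  simpa using h2.symm

/-- The composites of the projections of a direct sum with a nonzero morphism are linearly
independent. -/
lemma linearIndependent_biproduct_π_comp {r : ℕ} {A G : Coh k n} (t : A ⟶ G) (ht : t ≠ 0) :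
    LinearIndependent k (fun i : Fin r => biproduct.π (fun _ : Fin r => A) i ≫ t) := by
  rw [Fintype.linearIndependent_iff]
  intro c hc i
  have h := congrArg (fun f => biproduct.ι (fun _ : Fin r => A) i ≫ f) hc
  simp only [Preadditive.comp_sum, Linear.comp_smul, comp_zero] at h
  rw [Finset.sum_eq_single i, biproduct.ι_π_self_assoc] at h
  · exact (smul_eq_zero.1 h).resolve_right ht
  · intro j _ hj
    rw [biproduct.ι_π_ne_assoc _ (Ne.symm hj), zero_comp, smul_zero]
  · simp

/-- `F` is a sum of more copies of some `A = 𝒪(-i)` than the supposed dimension, and `A` is also a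
summand of `G`. The projections of `F` to its copies of `A`, followed by one inclusion into `G`, are
too many independent morphisms. -/
lemma not_finiteDimensional_hom (hn : 1 ≤ n) {F G : Coh k n} (hF : ¬ IsZero F) (hG : ¬ IsZero G) :
    ¬ FiniteDimensional k (F ⟶ G) := by
  intro hfin
  obtain ⟨i, hi⟩ := exists_iso_biproduct_of_not_isZero hn hF (Module.finrank k (F ⟶ G))
  obtain ⟨j, hj⟩ := exists_iso_biproduct_of_not_isZero hn hG 0
  obtain ⟨r, hr, ⟨e⟩⟩ := hi (max i j) (le_max_left _ _)
  obtain ⟨s, hs, ⟨e'⟩⟩ := hj (max i j) (le_max_right _ _)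
  set A := structureSheaf k n (-max i j)
  let t : A ⟶ G := biproduct.ι (fun _ : Fin s => A) ⟨0, hs⟩ ≫ e'.inv
  have ht : t ≠ 0 := by
    intro h
    apply not_isZero_structureSheaf (k := k) (n := n) (-max i j)
    rw [IsZero.iff_id_eq_zero]
    have := congrArg (fun f => f ≫ e'.hom ≫ biproduct.π (fun _ : Fin s => A) ⟨0, hs⟩) h
    simpa [t] using this
  have hli := (linearIndependent_biproduct_π_comp (r := r) t ht).map'
    (Linear.leftComp k G e.hom) (by
      rw [LinearMap.ker_eq_bot, injective_iff_map_eq_zero]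
      intro f hf
      exact (cancel_epi e.hom).1 (hf.trans comp_zero.symm))
  have := hli.fintype_card_le_finrank
  rw [Fintype.card_fin] at this
  omega

lemma exists_iso_sum_structureSheaf (F : Coh k n) : ∃ (m : ℕ) (d : Fin m → ℤ),
    Nonempty (F ≅ ⨁ fun j => structureSheaf k n (d j)) := by
  obtain ⟨i, hi⟩ := exists_iso_biproduct F
  obtain ⟨r, he⟩ := hi i le_rfl
  exact ⟨r, fun _ => -i, he⟩

/-! ### The Grothendieck group -/

/-! ### Grothendieck groups of arbitrary abelian categories. -/

section General

open ZeroObject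

universe v w

variable {C : Type w} [Category.{v} C] [Abelian C]

lemma K0.of_shortExact {S : ShortComplex C} (hS : S.ShortExact) :
    K0.of S.X₂ = K0.of S.X₁ + K0.of S.X₃ := by
  have : (QuotientAddGroup.mk (FreeAbelianGroup.of S.X₂ - FreeAbelianGroup.of S.X₁ -
      FreeAbelianGroup.of S.X₃) : K0 C) = 0 :=
    (QuotientAddGroup.eq_zero_iff _).2 (AddSubgroup.subset_closure ⟨S, hS, rfl⟩)
  have h : K0.of S.X₂ - K0.of S.X₁ - K0.of S.X₃ = 0 := this
  rw [sub_sub, sub_eq_zero] at h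
  exact h

lemma K0.of_biprod (X Y : C) : K0.of (X ⊞ Y) = K0.of X + K0.of Y :=
  K0.of_shortExact (S := ShortComplex.mk (biprod.inl : X ⟶ X ⊞ Y) biprod.snd (by simp))
    (ShortComplex.Splitting.ofHasBinaryBiproduct X Y).shortExact

/-- For a zero object, `X ⟶ X ⟶ X` is short exact, which gives `[X] = [X] + [X]`. -/
lemma K0.of_isZero {X : C} (h : IsZero X) : K0.of X = 0 := by
  have := K0.of_shortExact (S := ShortComplex.mk (𝟙 X) (0 : X ⟶ X) (by simp))
    (ShortComplex.Splitting.ofIsIsoOfIsZero _ (IsIso.id X) h).shortExact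
  simpa using this

lemma K0.of_congr {X Y : C} (e : X ≅ Y) : K0.of X = K0.of Y := by
  have := K0.of_shortExact (S := ShortComplex.mk e.hom (0 : Y ⟶ 0) (by simp))
    (ShortComplex.Splitting.ofIsIsoOfIsZero _ e.isIso_hom
      (isZero_zero C)).shortExact
  have h0 : K0.of (0 : C) = 0 := K0.of_isZero (isZero_zero C)
  simpa [h0] using this.symm

/-- Every element of the Grothendieck group is a difference of classes of objects. -/
lemma K0.exists_eq_sub (x : K0 C) : ∃ X Y : C, x = K0.of X - K0.of Y := by
  obtain ⟨x, rfl⟩ := QuotientAddGroup.mk_surjective x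
  have h0 : K0.of (0 : C) = 0 := K0.of_isZero (isZero_zero C)
  induction x using FreeAbelianGroup.induction_on with
  | zero => exact ⟨0, 0, by simp⟩
  | of X => exact ⟨X, 0, by rw [h0, sub_zero]; rfl⟩
  | neg X => exact ⟨0, X, by rw [h0, zero_sub]; rfl⟩
  | add x y hx hy =>
    obtain ⟨X, Y, h⟩ := hx
    obtain ⟨X', Y', h'⟩ := hy
    refine ⟨X ⊞ X', Y ⊞ Y', ?_⟩
    rw [QuotientAddGroup.mk_add, h, h', K0.of_biprod, K0.of_biprod]
    abel

/-- An additive invariant of objects defines a homomorphism on the Grothendieck group. -/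
def K0.lift {A : Type*} [AddCommGroup A] (ρ : C → A)
    (h : ∀ S : ShortComplex C, S.ShortExact → ρ S.X₂ = ρ S.X₁ + ρ S.X₃) : K0 C →+ A :=
  QuotientAddGroup.lift (K0Relations C) (FreeAbelianGroup.lift ρ) (by
    refine (AddSubgroup.closure_le _).2 ?_
    rintro _ ⟨S, hS, rfl⟩
    change FreeAbelianGroup.lift ρ _ = 0
    simp only [map_sub, FreeAbelianGroup.lift_apply_of, h S hS]
    abel)

lemma K0.lift_of {A : Type*} [AddCommGroup A] (ρ : C → A)
    (h : ∀ S : ShortComplex C, S.ShortExact → ρ S.X₂ = ρ S.X₁ + ρ S.X₃) (X : C) :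
    K0.lift ρ h (K0.of X) = ρ X :=
  FreeAbelianGroup.lift_apply_of ρ X

end General

/-! ### The rank isomorphism from `K₀` to `ℤ[1/(n+1)]`, realized as a subring of `ℚ`. -/

lemma zpow_mem_adjoin (n : ℕ) (i : ℤ) :
    ((n : ℚ) + 1) ^ i ∈ Algebra.adjoin ℤ {((n : ℚ) + 1)⁻¹} := by
  obtain ⟨q, rfl | rfl⟩ := i.eq_nat_or_neg
  · rw [zpow_natCast]
    have h : ((n : ℚ) + 1) ∈ Algebra.adjoin ℤ {((n : ℚ) + 1)⁻¹} :=
      Subalgebra.add_mem _ (Subalgebra.natCast_mem _ n) (Subalgebra.one_mem _)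
    exact Subalgebra.pow_mem _ h q
  · rw [zpow_neg, zpow_natCast, ← inv_pow]
    exact Subalgebra.pow_mem _ (Algebra.subset_adjoin (Set.mem_singleton _)) q

lemma rank_mem_adjoin (F : Coh k n) : rank F ∈ Algebra.adjoin ℤ {((n : ℚ) + 1)⁻¹} := by
  obtain ⟨i, hi⟩ := exists_iso_biproduct F
  obtain ⟨r, ⟨e⟩⟩ := hi i le_rfl
  rw [rank_congr e, rank_biproduct_structureSheaf]
  exact mul_mem (Subalgebra.natCast_mem _ r) (zpow_mem_adjoin n _)

lemma rank_of_shortExact (S : ShortComplex (Coh k n)) (hS : S.ShortExact) :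
    rank S.X₂ = rank S.X₁ + rank S.X₃ := by
  obtain ⟨s⟩ := nonempty_splitting S hS
  rw [rank_congr s.isoBinaryBiproduct, rank_biprod]

variable (k n) in
/-- The rank as a homomorphism from the Grothendieck group to `ℤ[1/(n+1)]`. -/
def rankHom : K0 (Coh k n) →+ Algebra.adjoin ℤ {((n : ℚ) + 1)⁻¹} :=
  K0.lift (fun F => ⟨rank F, rank_mem_adjoin F⟩) fun S hS => Subtype.ext (rank_of_shortExact S hS)

lemma rankHom_of (F : Coh k n) : (rankHom k n (K0.of F) : ℚ) = rank F :=
  congrArg Subtype.val (K0.lift_of _ _ F)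

/-- Every element is a difference `[F] - [G]`; if its rank is zero, then `F` and `G` have equal rank
and are isomorphic. -/
lemma rankHom_injective : Function.Injective (rankHom k n) := by
  rw [injective_iff_map_eq_zero]
  intro x hx
  obtain ⟨F, G, rfl⟩ := K0.exists_eq_sub x
  rw [map_sub, sub_eq_zero] at hx
  have h := congrArg Subtype.val hx
  rw [rankHom_of, rankHom_of] at h
  obtain ⟨e⟩ := nonempty_iso_of_rank_eq h
  rw [K0.of_congr e, sub_self]

lemma rankHom_surjective : Function.Surjective (rankHom k n) := by
  rintro ⟨x, hx⟩
  let S : AddSubgroup ℚ := (rankHom k n).range.map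
    (Algebra.adjoin ℤ {((n : ℚ) + 1)⁻¹}).subtype.toAddMonoidHom
  suffices h : x ∈ S by
    obtain ⟨_, ⟨y, rfl⟩, hy⟩ := h
    exact ⟨y, Subtype.ext hy⟩
  -- Additively, `ℤ[1/(n+1)]` is spanned by the powers `(n+1)^{-q}` with `q ≥ 0`, which are the
  -- ranks of the `𝒪(-q)`.
  rw [← Subalgebra.mem_toSubmodule, Algebra.adjoin_eq_span] at hx
  refine (Submodule.span_le (p := S.toIntSubmodule)).2 ?_ hx
  intro y hy
  obtain ⟨q, rfl⟩ := Submonoid.mem_closure_singleton.1 hy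
  refine ⟨_, ⟨K0.of (structureSheaf k n (-q)), rfl⟩, ?_⟩
  refine (rankHom_of _).trans ?_
  rw [rank_structureSheaf, zpow_neg, zpow_natCast, inv_pow]

end CohProperties

end FreeProj

end

theorem theorem1p3 {k : Type*} [Field k] (n : ℕ) (hn : 1 ≤ n) :
    -- no indecomposable, no simple, no nonzero noetherian objects
    (∀ F : FreeProj.Coh k n, ¬ Indecomposable F) ∧
    (∀ F : FreeProj.Coh k n, ¬ Simple F) ∧
    (∀ F : FreeProj.Coh k n, IsNoetherianObject F → IsZero F) ∧
    -- short exact sequences split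
    (∀ S : ShortComplex (FreeProj.Coh k n), S.ShortExact → Nonempty S.Splitting) ∧
    -- every object is a finite direct sum of objects `𝒪(i)`
    (∀ F : FreeProj.Coh k n, ∃ (m : ℕ) (d : Fin m → ℤ),
      Nonempty (F ≅ ⨁ fun j => FreeProj.structureSheaf k n (d j))) ∧
    -- indeed, of copies of a single `𝒪(-i)`, for all large `i`
    (∀ F : FreeProj.Coh k n, ∃ i₀ : ℤ, ∀ i : ℤ, i₀ ≤ i → ∃ r : ℕ,
      Nonempty (F ≅ ⨁ fun _ : Fin r => FreeProj.structureSheaf k n (-i))) ∧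
    -- spaces of morphisms between nonzero objects are infinite dimensional
    (∀ F G : FreeProj.Coh k n, ¬ IsZero F → ¬ IsZero G → ¬ FiniteDimensional k (F ⟶ G)) ∧
    -- the Grothendieck group
    (∃ e : FreeProj.K0 (FreeProj.Coh k n) ≃+ Algebra.adjoin ℤ {((n : ℚ) + 1)⁻¹},
      ∀ i : ℤ, (e (FreeProj.K0.of (FreeProj.structureSheaf k n i)) : ℚ) = ((n : ℚ) + 1) ^ i) :=
  ⟨FreeProj.not_indecomposable hn,
    fun F _ => FreeProj.not_indecomposable hn F (indecomposable_of_simple F),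
    fun F _ => FreeProj.isZero_of_isNoetherianObject hn F,
    FreeProj.nonempty_splitting,
    FreeProj.exists_iso_sum_structureSheaf,
    FreeProj.exists_iso_biproduct,
    fun _ _ => FreeProj.not_finiteDimensional_hom hn,
    AddEquiv.ofBijective (FreeProj.rankHom k n)
      ⟨FreeProj.rankHom_injective, FreeProj.rankHom_surjective⟩,
    fun _ => (FreeProj.rankHom_of _).trans (FreeProj.rank_structureSheaf _)⟩
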